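/- Let $\Omega\subseteq\mathbb R^2$ be open, let $\lambda,\mu\in C^\infty(\Omega)$ with $\mu\neq 0$ everywhere on $\Omega$, and consider the $2\times2$ hydrodynamic-type system in Jordan-block form $$u^1_t=\lambda(u^1,u^2)\,u^1_x+\mu(u^1,u^2)\,u^2_x,\qquad u^2_t=\lambda(u^1,u^2)\,u^2_x ,$$ that is, $u_t=A(u)u_x$ with $A=\begin{pmatrix}\lambda&\mu\\0&\lambda\end{pmatrix}$. *Linear degeneracy.* The system is linearly degenerate if, writing $\det(z\mathbb I-A)=z^2+f_1z+f_2$, one has $\nabla f_1\,A+\nabla f_2=0$ on $\Omega$. *Quasilinear constraints.* Let $W$ be an open set of points $(t,x,u)$ with $u\in\Omega$, and let $\varphi\in C^\infty(W)$. The constraint $u^2_x=\varphi(t,x,u)$ is compatible with the system on $W$ if the Schwarz condition $u^2_{xt}=u^2_{tx}$, i.e. $D_t\varphi=D_x(\lambda\varphi)$, holds identically in $(t,x,u)\in W$ and $u^1_x\in\mathbb R$, where $D_t,D_x$ are the total derivatives in which $u_t$ and $u^2_x$ are eliminated by means of the system and of the constraint. *Dubrovin–Novikov Hamiltonian structure.*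 The system is Hamiltonian in the Dubrovin–Novikov sense on an open set $V\subseteq\Omega$ if there are smooth functions $g^{ij},b^{ij}_k,h$ on $V$ with $\det(g^{ij})\ne0$ such that $P^{ij}=g^{ij}(u)\partial_x+b^{ij}_k(u)u^k_x$ is a Hamiltonian operator (the bracket $\{F,G\}=\int\frac{\delta F}{\delta u^i}P^{ij}\frac{\delta G}{\delta u^j}\,dx$ is skew-symmetric and satisfies the Jacobi identity; explicitly, this is required for the functionals $F_\psi[u]=\int\psi_i(x)u^i(x)\,dx$ with $\psi$ smooth and compactly supported, at every smooth field $u:\mathbb R\to V$) and $A^i_j(u)u^j_x=P^{ij}\frac{\partial h}{\partial u^j}$ for all smooth fields $u:\mathbb R\to V$. Then the following conditions are equivalent: (i) the system is linearly degenerate on $\Omega$; (i') $\partial\lambda/\partial u^1=0$ on $\Omega$; (ii) the system locally admits non-trivial quasilinear constraints: for every $u_0\in\Omega$ there are $t_0,x_0\in\mathbb R$, an open set $W\ni(t_0,x_0,u_0)$ of points $(t,x,u)$ with $u\in\Omega$, and a compatible constraint $u^2_x=\varphi(t,x,u)$ on $W$ such that $\varphi$ does not vanish identically on any non-empty open subset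 of $W$; (ii') for all open intervals $I,J$ (possibly unbounded) with $I\times J\subseteq\Omega$ there is a compatible constraint $u^2_x=\varphi(t,x,u)$ on $\mathbb R\times\mathbb R\times(I\times J)$ with $\varphi$ nowhere zero; (iii) the system is locally Hamiltonian in the Dubrovin–Novikov sense: every $u_0\in\Omega$ has an open neighbourhood $V\subseteq\Omega$ on which the system is Hamiltonian in this sense; (iii') the system is Hamiltonian in the Dubrovin–Novikov sense on every $I\times J\subseteq\Omega$ with $I,J$ open intervals (possibly unbounded). -/

import Mathlib

open scoped ContDiff

namespace HydroType

/-- The gradient `(∂f/∂u¹, …, ∂f/∂uⁿ)` of a function of the field variables. -/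
noncomputable def grad {n : ℕ} (f : (Fin n → ℝ) → ℝ) (u : Fin n → ℝ) : Fin n → ℝ :=
  fun k => fderiv ℝ f u (Pi.single k 1)

/-- Linear degeneracy on `Ω` of the quasilinear system `u_t = A(u) u_x`: if
`det (z I - A) = zⁿ + f₁ zⁿ⁻¹ + … + fₙ`, then `∇f₁ Aⁿ⁻¹ + ∇f₂ Aⁿ⁻² + … + ∇fₙ = 0` on `Ω`.
The coefficient of `zᵐ` is `f_{n-m}`, and its gradient is multiplied by `Aᵐ`. -/
def LinearlyDegenerateOn {n : ℕ} (A : (Fin n → ℝ) → Matrix (Fin n) (Fin n) ℝ)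
    (Ω : Set (Fin n → ℝ)) : Prop :=
  ∀ u ∈ Ω, ∑ m ∈ Finset.range n,
    Matrix.vecMul (grad (fun v => (A v).charpoly.coeff m) u) (A u ^ m) = 0

/-- The matrix of a `2 × 2` system in Jordan-block (upper-triangular Toeplitz) form:
`u¹_t = lam u¹_x + mu u²_x`, `u²_t = lam u²_x`. -/
def jordanBlock (lam mu : (Fin 2 → ℝ) → ℝ) (u : Fin 2 → ℝ) : Matrix (Fin 2) (Fin 2) ℝ :=
  !![lam u, mu u; 0, lam u]

/-- The set of pairs `(u¹, u²)` with `u¹ ∈ I` and `u² ∈ J`. -/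
def rectangle (I J : Set ℝ) : Set (Fin 2 → ℝ) := {u | u 0 ∈ I ∧ u 1 ∈ J}

/-! ### Quasilinear differential constraints `u²_x = φ(t, x, u)` -/

/-- The value of `u_x = (u¹_x, u²_x)` at the point `w = (t, x, u)` when `u¹_x = p` and
the constraint `u²_x = φ(t, x, u)` holds. -/
def xVelocity (φ : ℝ × ℝ × (Fin 2 → ℝ) → ℝ) (w : ℝ × ℝ × (Fin 2 → ℝ)) (p : ℝ) : Fin 2 → ℝ :=
  ![p, φ w]

/-- Total `x`-derivative of `F(t, x, u)`, evaluated with `u¹_x = p` and `u²_x = φ`. -/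
noncomputable def totalDx (φ F : ℝ × ℝ × (Fin 2 → ℝ) → ℝ)
    (w : ℝ × ℝ × (Fin 2 → ℝ)) (p : ℝ) : ℝ :=
  fderiv ℝ F w (0, 1, xVelocity φ w p)

/-- Total `t`-derivative of `F(t, x, u)` along the system `u_t = A(u) u_x`, evaluated with
`u¹_x = p` and `u²_x = φ`. -/
noncomputable def totalDt (A : (Fin 2 → ℝ) → Matrix (Fin 2) (Fin 2) ℝ)
    (φ F : ℝ × ℝ × (Fin 2 → ℝ) → ℝ) (w : ℝ × ℝ × (Fin 2 → ℝ)) (p : ℝ) : ℝ :=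
  fderiv ℝ F w (1, 0, Matrix.mulVec (A w.2.2) (xVelocity φ w p))

/-- The constraint `u²_x = φ(t, x, u)`, with `φ` smooth on the open set `W` of `(t, x, u)`-space,
is compatible with the Jordan-block system: the two expressions `D_t (u²_x) = D_t φ` and
`D_x (u²_t) = D_x (lam φ)` for the mixed derivative `u²_{xt}`, in which `u_t` is eliminated by the
system and `u²_x` by the constraint, agree identically in `(t, x, u) ∈ W` and `p = u¹_x`. -/
structure IsCompatibleConstraint (lam mu : (Fin 2 → ℝ) → ℝ)
    (W : Set (ℝ × ℝ × (Fin 2 → ℝ))) (φ : ℝ × ℝ × (Fin 2 → ℝ) → ℝ) : Prop where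
  smooth : ContDiffOn ℝ ∞ φ W
  schwarz : ∀ w ∈ W, ∀ p : ℝ,
    totalDt (jordanBlock lam mu) φ φ w p = totalDx φ (fun z => lam z.2.2 * φ z) w p

/-! ### Hamiltonian operators of Dubrovin–Novikov type -/

/-- The operator `P^{ij} = g^{ij}(u) ∂_x + b^{ij}_k(u) u^k_x`, at the field `x ↦ u(x)`, applied
to the covector field `x ↦ ψ(x)`. Here `b i j k` is `b^{ij}_k`. -/
noncomputable def dnOperator {n : ℕ} (g : (Fin n → ℝ) → Matrix (Fin n) (Fin n) ℝ)
    (b : Fin n → Fin n → Fin n → (Fin n → ℝ) → ℝ)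
    (u ψ : ℝ → Fin n → ℝ) (x : ℝ) : Fin n → ℝ :=
  fun i => ∑ j, g (u x) i j * deriv ψ x j + ∑ j, ∑ k, b i j k (u x) * deriv u x k * ψ x j

/-- The derivative `d/dε P_{u + ε v} ψ` at `ε = 0`: the linearization of the coefficients of the
operator at the field `u` in the direction `v`, applied to `ψ`. -/
noncomputable def dnOperatorVariation {n : ℕ} (g : (Fin n → ℝ) → Matrix (Fin n) (Fin n) ℝ)
    (b : Fin n → Fin n → Fin n → (Fin n → ℝ) → ℝ)
    (u v ψ : ℝ → Fin n → ℝ) (x : ℝ) : Fin n → ℝ :=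
  fun i => deriv (fun ε : ℝ => dnOperator g b (u + ε • v) ψ x i) 0

/-- Smooth compactly supported covector fields on the line. -/
def IsTestCovector {n : ℕ} (ψ : ℝ → Fin n → ℝ) : Prop :=
  ContDiff ℝ ∞ ψ ∧ HasCompactSupport ψ

/-- Smooth fields `x ↦ u(x)` with values in `V`. -/
def IsFieldIn {n : ℕ} (V : Set (Fin n → ℝ)) (u : ℝ → Fin n → ℝ) : Prop :=
  ContDiff ℝ ∞ u ∧ ∀ x, u x ∈ V

/-- The operator `P = g ∂_x + b u_x` with smooth coefficients on `V` is a non-degenerate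
Hamiltonian operator: `det g ≠ 0`, and the bracket
`{F_ψ, F_χ}[u] = ∫ ψ · P_u χ dx` of the functionals `F_ψ[u] = ∫ ψ · u dx` is skew-symmetric and
satisfies the Jacobi identity. Since `{{F_ψ, F_χ}, F_η}` is the derivative of
`{F_ψ, F_χ}` in the direction `P_u η`, the latter says that the cyclic sum
of `∫ ψ · (d/dε P_{u + ε P_u η}) χ dx` vanishes. -/
structure IsHamiltonianOperatorOn {n : ℕ} (V : Set (Fin n → ℝ))
    (g : (Fin n → ℝ) → Matrix (Fin n) (Fin n) ℝ)
    (b : Fin n → Fin n → Fin n → (Fin n → ℝ) → ℝ) : Prop where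
  smooth_g : ∀ i j, ContDiffOn ℝ ∞ (fun u => g u i j) V
  smooth_b : ∀ i j k, ContDiffOn ℝ ∞ (b i j k) V
  nondegenerate : ∀ u ∈ V, (g u).det ≠ 0
  skew : ∀ u, IsFieldIn V u → ∀ ψ χ : ℝ → Fin n → ℝ, IsTestCovector ψ → IsTestCovector χ →
    (∫ x, ψ x ⬝ᵥ dnOperator g b u χ x) = -∫ x, χ x ⬝ᵥ dnOperator g b u ψ x
  jacobi : ∀ u, IsFieldIn V u → ∀ ψ χ η : ℝ → Fin n → ℝ,
    IsTestCovector ψ → IsTestCovector χ → IsTestCovector η →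
    (∫ x, ψ x ⬝ᵥ dnOperatorVariation g b u (dnOperator g b u η) χ x)
      + (∫ x, χ x ⬝ᵥ dnOperatorVariation g b u (dnOperator g b u ψ) η x)
      + (∫ x, η x ⬝ᵥ dnOperatorVariation g b u (dnOperator g b u χ) ψ x) = 0

/-- The system `u_t = A(u) u_x` is Hamiltonian on `V` in the Dubrovin–Novikov sense: there are a
non-degenerate Hamiltonian operator `P = g ∂_x + b u_x` and a smooth Hamiltonian density `h(u)`
with `A(u) u_x = P (∂h/∂u)`. -/
def IsHamiltonianDNOn {n : ℕ} (A : (Fin n → ℝ) → Matrix (Fin n) (Fin n) ℝ)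
    (V : Set (Fin n → ℝ)) : Prop :=
  ∃ (g : (Fin n → ℝ) → Matrix (Fin n) (Fin n) ℝ)
    (b : Fin n → Fin n → Fin n → (Fin n → ℝ) → ℝ) (h : (Fin n → ℝ) → ℝ),
    IsHamiltonianOperatorOn V g b ∧ ContDiffOn ℝ ∞ h V ∧
    ∀ u, IsFieldIn V u → ∀ x,
      Matrix.mulVec (A (u x)) (deriv u x) = dnOperator g b u (fun y => grad h (u y)) x

end HydroType

/-! Everything is compared with the condition ∂₁λ = 0, where ∂ₖ is the derivative in uᵏ. Linear
degeneracy is a direct computation: ∇f₁ A + ∇f₂ = (0, -2μ ∂₁λ).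

Constraints. Since A u_x = λ u_x + (μ u²_x, 0), the operator D_t - λ D_x does not see u¹_x, and the
Schwarz condition becomes φ_t - λ φ_x + μ φ ∂₁φ = φ (p ∂₁λ + φ ∂₂λ). Its p-coefficient gives φ ∂₁λ =
0, hence ∂₁λ = 0 where φ ≠ 0, and then everywhere by density. Conversely, if ∂₁λ = 0, then ∂₂λ does
not depend on u¹, and φ = exp(∂₂λ ∫ du¹/μ) solves μ ∂₁φ = φ ∂₂λ (`exists_integrating_factor`).

Hamiltonian ⇒ ∂₁λ = 0. Skew-symmetry gives that g is symmetric and ∂ₖg^{ij} = b^{ij}_k + b^{ji}_k.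
The Jacobi identity with one covector equal to ∂h/∂u says that the Lie derivative of P along K = A
u_x vanishes (`IsHamiltonianOperatorOn.lieDerivative_eq_zero`). On constant fields this makes A g
symmetric, so μ g²² = 0. On a field in the u¹ direction, at a point where u_x = 0 and u_xx ≠ 0, it
gives g²¹ ∂₁λ = μ b²²₁. As g²² vanishes identically, b²²₁ = 0, while det g ≠ 0 forces g²¹ ≠ 0; hence
∂₁λ = 0.

∂₁λ = 0 ⇒ Hamiltonian. The same φ, normalized to 1 on u¹ = a, provides a flat coordinate v with ∂₁v
= φ/μ and v = 0 on u¹ = a; then φ = v ∂₂λ + 1. In the coordinates (v, u²) the system is v_t = (λ v +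
u²)_x, u²_t = L_x, with L' = λ. This is the constant antidiagonal operator applied to the gradient
of h = L v + (u²)²/2. That the operator remains Hamiltonian in the original coordinates is
`isHamiltonianOperatorOn_frame`. -/

namespace HydroType

open MeasureTheory Set Filter Topology

/-! ### Smooth dependence of integrals on parameters -/

section ParametricIntegral

variable {E : Type} [NormedAddCommGroup E] [NormedSpace ℝ E] [ProperSpace E]

theorem hasFDerivAt_integral_of_contDiffOn {F : Type} [NormedAddCommGroup F] [NormedSpace ℝ F]
    {V : Set E} (hV : IsOpen V) {U : Set (ℝ × E)} (hU : IsOpen U)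
    (hUV : Icc (0 : ℝ) 1 ×ˢ V ⊆ U) {f : ℝ × E → F} (hf : ContDiffOn ℝ ∞ f U) {x₀ : E}
    (hx₀ : x₀ ∈ V) :
    HasFDerivAt (fun x => ∫ τ in (0 : ℝ)..1, f (τ, x))
      (∫ τ in (0 : ℝ)..1, (fderiv ℝ f (τ, x₀)).comp (ContinuousLinearMap.inr ℝ ℝ E)) x₀ := by
  obtain ⟨K, hK, hKx, hKV⟩ : ∃ K, IsCompact K ∧ K ∈ 𝓝 x₀ ∧ K ⊆ V := by
    obtain ⟨K, hK, hKV, hKc⟩ := local_compact_nhds (hV.mem_nhds hx₀)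
    exact ⟨K, hKc, hK, hKV⟩
  have hf' : ContinuousOn (fun p : ℝ × E =>
      (fderiv ℝ f p).comp (ContinuousLinearMap.inr ℝ ℝ E)) U :=
    (hf.continuousOn_fderiv_of_isOpen hU (by simp)).clm_comp continuousOn_const
  have hslice : ∀ x ∈ V, MapsTo (fun τ : ℝ => (τ, x)) (Icc 0 1) U :=
    fun x hx τ hτ => hUV ⟨hτ, hx⟩
  have hsc : ∀ x : E, ContinuousOn (fun τ : ℝ => (τ, x)) (Icc 0 1) := fun x => by fun_prop
  have huIoc : uIoc (0 : ℝ) 1 ⊆ Icc 0 1 := by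
    rw [uIoc_of_le zero_le_one]; exact Ioc_subset_Icc_self
  obtain ⟨C, hC⟩ := ((isCompact_Icc (a := (0 : ℝ)) (b := 1)).prod hK).exists_bound_of_continuousOn
    (hf'.mono ((prod_mono_right hKV).trans hUV))
  refine intervalIntegral.hasFDerivAt_integral_of_dominated_of_fderiv_le (bound := fun _ => C)
    (F' := fun x τ => (fderiv ℝ f (τ, x)).comp (ContinuousLinearMap.inr ℝ ℝ E)) hKx ?_ ?_ ?_ ?_ ?_ ?_
  · filter_upwards [hKx] with x hx
    exact ((hf.continuousOn.comp (hsc x) (hslice x (hKV hx))).mono huIoc).aestronglyMeasurable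
      measurableSet_uIoc
  · apply ContinuousOn.intervalIntegrable
    rw [uIcc_of_le zero_le_one]
    exact hf.continuousOn.comp (hsc x₀) (hslice x₀ hx₀)
  · exact ((hf'.comp (hsc x₀) (hslice x₀ hx₀)).mono huIoc).aestronglyMeasurable
      measurableSet_uIoc
  · exact ae_of_all _ fun τ hτ x hx => hC (τ, x) ⟨huIoc hτ, hx⟩
  · exact intervalIntegrable_const
  · refine ae_of_all _ fun τ hτ x hx => ?_
    have h1 : HasFDerivAt f (fderiv ℝ f (τ, x)) (τ, x) :=
      ((hf.contDiffAt (hU.mem_nhds (hUV ⟨huIoc hτ, hKV hx⟩))).differentiableAt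
        (by simp)).hasFDerivAt
    exact h1.comp x (hasFDerivAt_prodMk_right τ x)

/-- Differentiating under the integral sign gives an integral of the same kind, but with values in
continuous linear maps; the induction therefore keeps the target space `F` general. -/
theorem contDiffOn_integral_nat {V : Set E} (hV : IsOpen V) {U : Set (ℝ × E)} (hU : IsOpen U)
    (hUV : Icc (0 : ℝ) 1 ×ˢ V ⊆ U) (n : ℕ) :
    ∀ {F : Type} [NormedAddCommGroup F] [NormedSpace ℝ F] {f : ℝ × E → F},
      ContDiffOn ℝ ∞ f U → ContDiffOn ℝ n (fun x => ∫ τ in (0 : ℝ)..1, f (τ, x)) V := by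
  induction n with
  | zero =>
    intro F _ _ f hf
    refine contDiffOn_zero.2 fun x hx => ?_
    exact (hasFDerivAt_integral_of_contDiffOn hV hU hUV hf hx).continuousAt.continuousWithinAt
  | succ n ih =>
    intro F _ _ f hf
    have hd := fun x hx => hasFDerivAt_integral_of_contDiffOn hV hU hUV hf (x₀ := x) hx
    rw [Nat.cast_succ, contDiffOn_succ_iff_fderiv_of_isOpen hV]
    refine ⟨fun x hx => (hd x hx).differentiableAt.differentiableWithinAt, by simp, ?_⟩
    refine (ih (f := fun p => (fderiv ℝ f p).comp (ContinuousLinearMap.inr ℝ ℝ E)) ?_).congr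
      fun x hx => (hd x hx).fderiv
    exact (hf.fderiv_of_isOpen hU (by simp)).clm_comp contDiffOn_const

/-- An integral over `[0, 1]` depending smoothly on a parameter is a smooth function of it. -/
theorem contDiffOn_integral {V : Set E} (hV : IsOpen V) {U : Set (ℝ × E)} (hU : IsOpen U)
    (hUV : Icc (0 : ℝ) 1 ×ˢ V ⊆ U) {F : Type} [NormedAddCommGroup F] [NormedSpace ℝ F]
    {f : ℝ × E → F} (hf : ContDiffOn ℝ ∞ f U) :
    ContDiffOn ℝ ∞ (fun x => ∫ τ in (0 : ℝ)..1, f (τ, x)) V :=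
  contDiffOn_infty.2 fun n => contDiffOn_integral_nat hV hU hUV n hf

end ParametricIntegral

/-! ### Rectangles and antiderivatives in the first variable -/

theorem isOpen_rectangle {I J : Set ℝ} (hI : IsOpen I) (hJ : IsOpen J) :
    IsOpen (rectangle I J) :=
  (hI.preimage (continuous_apply 0)).inter (hJ.preimage (continuous_apply 1))

theorem hasDerivAt_comp_fst_coord {f : (Fin 2 → ℝ) → ℝ} {u : Fin 2 → ℝ}
    (hf : DifferentiableAt ℝ f u) :
    HasDerivAt (fun s => f ![s, u 1]) (grad f u 0) (u 0) := by
  have hu : ![u 0, u 1] = u := by ext i; fin_cases i <;> rfl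
  have h1 : HasDerivAt (fun s : ℝ => (![s, u 1] : Fin 2 → ℝ)) (Pi.single 0 1) (u 0) := by
    rw [hasDerivAt_pi]
    intro i
    fin_cases i
    · exact hasDerivAt_id' (u 0)
    · simpa using hasDerivAt_const (u 0) (u 1)
  have h2 : HasFDerivAt f (fderiv ℝ f u) ![u 0, u 1] := by rw [hu]; exact hf.hasFDerivAt
  exact h2.comp_hasDerivAt (u 0) h1

/-- On a rectangle, every smooth function has a smooth antiderivative in the first variable. -/
theorem exists_antideriv_rectangle {I J : Set ℝ} (hI : IsOpen I) (hI' : I.OrdConnected)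
    (hJ : IsOpen J) {a : ℝ} (ha : a ∈ I) {F : (Fin 2 → ℝ) → ℝ}
    (hF : ContDiffOn ℝ ∞ F (rectangle I J)) :
    ∃ G : (Fin 2 → ℝ) → ℝ, ContDiffOn ℝ ∞ G (rectangle I J) ∧
      (∀ u ∈ rectangle I J, grad G u 0 = F u) ∧ ∀ u, u 0 = a → G u = 0 := by
  have hR := isOpen_rectangle hI hJ
  -- The integral from a to u¹ is rescaled to [0, 1], so that u enters only as a parameter of the
  -- integrand and `contDiffOn_integral` applies.
  let S : ℝ × (Fin 2 → ℝ) → (Fin 2 → ℝ) := fun p => ![a + (p.2 0 - a) * p.1, p.2 1]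
  have hS : ContDiff ℝ ∞ S := by
    rw [contDiff_pi]
    intro i
    fin_cases i
    · simp only [S]; simp; fun_prop
    · simp only [S]; simp; fun_prop
  have hSmem : Icc (0 : ℝ) 1 ×ˢ rectangle I J ⊆ S ⁻¹' rectangle I J := by
    rintro ⟨τ, u⟩ ⟨⟨h0, h1⟩, hu0, hu1⟩
    refine ⟨?_, hu1⟩
    have := hI'.convex ha hu0 (a := 1 - τ) (b := τ) (by simpa using h1) h0 (by ring)
    simp only [smul_eq_mul] at this
    simp only [S, Matrix.cons_val_zero]
    convert this using 1
    ring
  have hsm : ContDiffOn ℝ ∞ (fun u => (u 0 - a) * ∫ τ in (0 : ℝ)..1, F (S (τ, u)))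
      (rectangle I J) := by
    refine ContDiffOn.mul (by fun_prop) ?_
    exact contDiffOn_integral hR (hR.preimage hS.continuous) hSmem
      (f := fun p => F (S p)) (hF.comp hS.contDiffOn fun p hp => hp)
  refine ⟨_, hsm, ?_, ?_⟩
  · intro u hu
    have hG := (hsm.contDiffAt (hR.mem_nhds hu)).differentiableAt (by simp)
    refine (hasDerivAt_comp_fst_coord hG).unique ?_
    have hc : ContinuousOn (fun r => F ![r, u 1]) I := by
      refine hF.continuousOn.comp ?_ fun r hr => ⟨hr, hu.2⟩
      refine Continuous.continuousOn (continuous_pi fun i => ?_)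
      fin_cases i
      · exact continuous_id
      · exact continuous_const
    have hu' : ![u 0, u 1] = u := by ext i; fin_cases i <;> rfl
    have hint : HasDerivAt (fun s => ∫ r in a..s, F ![r, u 1]) (F u) (u 0) := by
      have := intervalIntegral.integral_hasDerivAt_right
        (f := fun r => F ![r, u 1]) (a := a) (b := u 0)
        (hc.mono (hI'.uIcc_subset ha hu.1)).intervalIntegrable
        (hc.stronglyMeasurableAtFilter hI _ hu.1) (hc.continuousAt (hI.mem_nhds hu.1))
      rwa [hu'] at this
    refine hint.congr_of_eventuallyEq (Eventually.of_forall fun s => ?_)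
    have := intervalIntegral.mul_integral_comp_add_mul (a := 0) (b := 1)
      (f := fun r => F ![r, u 1]) (s - a) a
    simpa [S] using this
  · intro u hu
    simp [hu]

/-! ### Calculus of gradients and second derivatives -/

section Gradient

variable {n : ℕ} {V : Set (Fin n → ℝ)} {f : (Fin n → ℝ) → ℝ}

theorem sum_grad_mul (f : (Fin n → ℝ) → ℝ) (u p : Fin n → ℝ) :
    ∑ k, grad f u k * p k = fderiv ℝ f u p := by
  conv_rhs => rw [← Finset.univ_sum_single p, map_sum]
  refine Finset.sum_congr rfl fun k _ => ?_
  have : (Pi.single k (p k) : Fin n → ℝ) = p k • Pi.single k 1 := by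
    rw [← Pi.single_smul, smul_eq_mul, mul_one]
  rw [this, map_smul, smul_eq_mul, mul_comm, grad]

theorem fderiv_fin_two (f : (Fin 2 → ℝ) → ℝ) (u p : Fin 2 → ℝ) :
    fderiv ℝ f u p = grad f u 0 * p 0 + grad f u 1 * p 1 := by
  rw [← sum_grad_mul, Fin.sum_univ_two]

theorem contDiffOn_grad (hV : IsOpen V) (hf : ContDiffOn ℝ ∞ f V) (k : Fin n) :
    ContDiffOn ℝ ∞ (fun u => grad f u k) V :=
  (hf.fderiv_of_isOpen hV (by simp)).clm_apply contDiffOn_const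

theorem differentiableAt_of_contDiffOn {E F : Type*} [NormedAddCommGroup E] [NormedSpace ℝ E]
    [NormedAddCommGroup F] [NormedSpace ℝ F] {V : Set E} {f : E → F} (hV : IsOpen V)
    (hf : ContDiffOn ℝ ∞ f V) {u : E} (hu : u ∈ V) : DifferentiableAt ℝ f u :=
  (hf.contDiffAt (hV.mem_nhds hu)).differentiableAt (by simp)

theorem fderiv_fderiv_comm {E : Type*} [NormedAddCommGroup E] [NormedSpace ℝ E] {V : Set E}
    {f : E → ℝ} (hV : IsOpen V) (hf : ContDiffOn ℝ ∞ f V)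
    {u : E} (hu : u ∈ V) (p q : E) :
    fderiv ℝ (fderiv ℝ f) u p q = fderiv ℝ (fderiv ℝ f) u q p :=
  (hf.contDiffAt (hV.mem_nhds hu)).isSymmSndFDerivAt
    (by rw [minSmoothness_of_isRCLikeNormedField]; exact WithTop.coe_le_coe.2 (le_top (a := (2 : ℕ∞)))) p q

theorem fderiv_fderiv_apply {E : Type*} [NormedAddCommGroup E] [NormedSpace ℝ E] {V : Set E}
    {f : E → ℝ} (hV : IsOpen V) (hf : ContDiffOn ℝ ∞ f V)
    {u : E} (hu : u ∈ V) (p q : E) :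
    fderiv ℝ (fun v => fderiv ℝ f v q) u p = fderiv ℝ (fderiv ℝ f) u p q := by
  have h1 : DifferentiableAt ℝ (fderiv ℝ f) u :=
    differentiableAt_of_contDiffOn hV (hf.fderiv_of_isOpen hV (by simp)) hu
  have := (h1.hasFDerivAt.clm_apply (hasFDerivAt_const q u)).fderiv
  rw [this]
  simp

theorem grad_grad_comm (hV : IsOpen V) (hf : ContDiffOn ℝ ∞ f V) {u : Fin n → ℝ} (hu : u ∈ V)
    (k l : Fin n) : grad (fun v => grad f v k) u l = grad (fun v => grad f v l) u k := by
  simp only [grad]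
  rw [fderiv_fderiv_apply hV hf hu, fderiv_fderiv_apply hV hf hu, fderiv_fderiv_comm hV hf hu]

theorem grad_congr {g : (Fin n → ℝ) → ℝ} (hV : IsOpen V) (h : ∀ u ∈ V, f u = g u)
    {u : Fin n → ℝ} (hu : u ∈ V) : grad f u = grad g u := by
  have : f =ᶠ[𝓝 u] g := by filter_upwards [hV.mem_nhds hu] with v hv using h v hv
  ext k
  rw [grad, grad, this.fderiv_eq]

theorem grad_mul {g : (Fin n → ℝ) → ℝ} {u : Fin n → ℝ} (hf : DifferentiableAt ℝ f u)
    (hg : DifferentiableAt ℝ g u) (k : Fin n) :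
    grad (fun v => f v * g v) u k = f u * grad g u k + g u * grad f u k := by
  rw [grad, fderiv_fun_mul hf hg]
  simp [grad]

theorem grad_add {g : (Fin n → ℝ) → ℝ} {u : Fin n → ℝ} (hf : DifferentiableAt ℝ f u)
    (hg : DifferentiableAt ℝ g u) (k : Fin n) :
    grad (fun v => f v + g v) u k = grad f u k + grad g u k := by
  rw [grad, fderiv_fun_add hf hg]
  simp [grad]

end Gradient

/-! ### Linear degeneracy -/

section LinearDegeneracy

variable {Ω : Set (Fin 2 → ℝ)} {lam mu : (Fin 2 → ℝ) → ℝ}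

/-- Here f₁ = -2λ and f₂ = λ², so the first component of ∇f₁ A + ∇f₂ cancels identically and the
second is -2μ ∂₁λ. -/
theorem linearlyDegenerateOn_jordanBlock_iff (hΩ : IsOpen Ω) (hlam : ContDiffOn ℝ ∞ lam Ω)
    (hmu0 : ∀ u ∈ Ω, mu u ≠ 0) :
    LinearlyDegenerateOn (jordanBlock lam mu) Ω ↔ ∀ u ∈ Ω, grad lam u 0 = 0 := by
  refine forall₂_congr fun u hu => ?_
  have hd := differentiableAt_of_contDiffOn hΩ hlam hu
  have h0 : (fun v => (jordanBlock lam mu v).charpoly.coeff 0) = fun v => lam v * lam v := by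
    ext v
    simp [Matrix.charpoly_fin_two, jordanBlock, Matrix.det_fin_two, Polynomial.coeff_X]
  have h1 : (fun v => (jordanBlock lam mu v).charpoly.coeff 1) = fun v => (-2) * lam v := by
    ext v
    simp [Matrix.charpoly_fin_two, jordanBlock, Matrix.trace_fin_two, Polynomial.coeff_C]
    ring
  have g1 : ∀ k, grad (fun v => (-2) * lam v) u k = -2 * grad lam u k := fun k => by
    rw [grad_mul (by fun_prop) hd]
    simp [grad]
  have g0 : ∀ k, grad (fun v => lam v * lam v) u k = 2 * lam u * grad lam u k := fun k => by
    rw [grad_mul hd hd]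
    ring
  rw [Finset.sum_range_succ, Finset.sum_range_one, h0, h1, funext_iff, Fin.forall_fin_two]
  simp only [Pi.add_apply, pow_zero, pow_one, Matrix.vecMul_one, Matrix.vecMul, dotProduct,
    Fin.sum_univ_two, g0, g1]
  simp [jordanBlock]
  constructor
  · rintro ⟨-, h⟩
    have : mu u * grad lam u 0 = 0 := by linarith
    simpa [hmu0 u hu] using this
  · intro h
    rw [h]
    constructor <;> ring

end LinearDegeneracy

/-! ### Quasilinear constraints -/

section Constraints

variable {Ω : Set (Fin 2 → ℝ)} {lam mu : (Fin 2 → ℝ) → ℝ}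

/-- The Schwarz condition of the constraint `u²_x = φ`, with the `x`-derivatives collected. -/
theorem schwarz_iff {φ : ℝ × ℝ × (Fin 2 → ℝ) → ℝ} {w : ℝ × ℝ × (Fin 2 → ℝ)}
    (hφ : DifferentiableAt ℝ φ w) (hlam : DifferentiableAt ℝ lam w.2.2) (p : ℝ) :
    totalDt (jordanBlock lam mu) φ φ w p = totalDx φ (fun z => lam z.2.2 * φ z) w p ↔
      fderiv ℝ φ w (1, -lam w.2.2, ![mu w.2.2 * φ w, 0]) =
        φ w * (grad lam w.2.2 0 * p + grad lam w.2.2 1 * φ w) := by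
  have h1 : HasFDerivAt (fun z : ℝ × ℝ × (Fin 2 → ℝ) => lam z.2.2)
      ((fderiv ℝ lam w.2.2).comp ((ContinuousLinearMap.snd ℝ ℝ (Fin 2 → ℝ)).comp
        (ContinuousLinearMap.snd ℝ ℝ (ℝ × (Fin 2 → ℝ))))) w :=
    hlam.hasFDerivAt.comp w (hasFDerivAt_snd.comp w hasFDerivAt_snd)
  have h2 := (h1.mul hφ.hasFDerivAt).fderiv
  -- The direction of D_t is λ times that of D_x plus a vector free of p, because the nilpotent part
  -- of A only picks out u²_x = φ.
  have hv : ((1, 0, Matrix.mulVec (jordanBlock lam mu w.2.2) (xVelocity φ w p)) :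
      ℝ × ℝ × (Fin 2 → ℝ)) = (1, -lam w.2.2, ![mu w.2.2 * φ w, 0]) +
        lam w.2.2 • (0, 1, xVelocity φ w p) := by
    refine Prod.ext (by simp) (Prod.ext (by simp) ?_)
    ext i
    fin_cases i
    · simp [jordanBlock, xVelocity, Matrix.mulVec, dotProduct]
      ring
    · simp [jordanBlock, xVelocity, Matrix.mulVec, dotProduct]
  rw [totalDt, totalDx, hv, map_add, map_smul]
  erw [h2]
  simp only [add_apply, smul_apply,   ContinuousLinearMap.comp_apply, ContinuousLinearMap.coe_snd', smul_eq_mul,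
    fderiv_fin_two lam]
  simp only [xVelocity, Matrix.cons_val_zero, Matrix.cons_val_one]
  constructor <;> intro h <;> linarith

theorem grad_eq_zero_of_isCompatibleConstraint (hΩ : IsOpen Ω) (hlam : ContDiffOn ℝ ∞ lam Ω)
    {W : Set (ℝ × ℝ × (Fin 2 → ℝ))} {φ : ℝ × ℝ × (Fin 2 → ℝ) → ℝ} (hW : IsOpen W)
    (hWΩ : ∀ w ∈ W, w.2.2 ∈ Ω) (hc : IsCompatibleConstraint lam mu W φ)
    (hcl : W ⊆ closure {w ∈ W | φ w ≠ 0}) {w : ℝ × ℝ × (Fin 2 → ℝ)} (hw : w ∈ W) :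
    grad lam w.2.2 0 = 0 := by
  have key : ∀ z ∈ {w ∈ W | φ w ≠ 0}, grad lam z.2.2 0 = 0 := by
    rintro z ⟨hz, hφz⟩
    have hs := fun p => (schwarz_iff (mu := mu) (differentiableAt_of_contDiffOn hW hc.smooth hz)
      (differentiableAt_of_contDiffOn hΩ hlam (hWΩ z hz)) p).1 (hc.schwarz z hz p)
    -- The left side of the Schwarz equation is independent of p; comparing p = 0 with p = 1
    -- isolates the coefficient of p.
    have h : φ z * grad lam z.2.2 0 = 0 := by linarith [hs 0, hs 1]
    exact (mul_eq_zero.1 h).resolve_left hφz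
  have hcont : ContinuousAt (fun z : ℝ × ℝ × (Fin 2 → ℝ) => grad lam z.2.2 0) w :=
    ContinuousAt.comp (f := fun z : ℝ × ℝ × (Fin 2 → ℝ) => z.2.2)
      (g := fun u => grad lam u 0)
      ((contDiffOn_grad hΩ hlam 0).continuousOn.continuousAt (hΩ.mem_nhds (hWΩ w hw)))
      (by fun_prop)
  have := hcont.continuousWithinAt.mem_closure_image (hcl hw)
  have hsub : (fun z : ℝ × ℝ × (Fin 2 → ℝ) => grad lam z.2.2 0) '' {w ∈ W | φ w ≠ 0} ⊆ {0} := by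
    rintro _ ⟨z, hz, rfl⟩
    exact key z hz
  simpa using closure_mono hsub this

/-- When `∂lam/∂u¹ = 0`, the equation `mu ∂φ/∂u¹ = (∂lam/∂u²) φ` has a positive solution on every
rectangle. -/
theorem exists_integrating_factor {I J : Set ℝ} (hI : IsOpen I) (hI' : I.OrdConnected)
    (hJ : IsOpen J) {a : ℝ} (ha : a ∈ I) (hlam : ContDiffOn ℝ ∞ lam (rectangle I J))
    (hmu : ContDiffOn ℝ ∞ mu (rectangle I J)) (hmu0 : ∀ u ∈ rectangle I J, mu u ≠ 0)
    (h : ∀ u ∈ rectangle I J, grad lam u 0 = 0) :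
    ∃ φ : (Fin 2 → ℝ) → ℝ, ContDiffOn ℝ ∞ φ (rectangle I J) ∧ (∀ u, 0 < φ u) ∧
      (∀ u ∈ rectangle I J, mu u * grad φ u 0 = grad lam u 1 * φ u) ∧
      ∀ u, u 0 = a → φ u = 1 := by
  have hR := isOpen_rectangle hI hJ
  obtain ⟨m, hm, hm', hma⟩ := exists_antideriv_rectangle hI hI' hJ ha (hmu.inv hmu0)
  have hl := contDiffOn_grad hR hlam 1
  -- With ∂₁m = 1/μ and ∂₂λ independent of u¹, the exponent has u¹-derivative ∂₂λ/μ; m = 0 on u¹ = a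
  -- gives the normalization.
  refine ⟨fun u => Real.exp (grad lam u 1 * m u), (hl.mul hm).exp, fun u => Real.exp_pos _, ?_,
    fun u hu => by simp [hma u hu]⟩
  intro u hu
  have hld := differentiableAt_of_contDiffOn hR hl hu
  have hmd := differentiableAt_of_contDiffOn hR hm hu
  have h0 : grad (fun v => grad lam v 1) u 0 = 0 := by
    rw [grad_grad_comm hR hlam hu, grad_congr hR h hu]
    simp [grad]
  have h1 := grad_mul hld hmd 0
  rw [h0, hm' u hu] at h1
  rw [grad, fderiv_exp (hld.fun_mul hmd), FunLike.coe_smul, Pi.smul_apply, ← grad, h1, smul_eq_mul]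
  have := hmu0 u hu
  simp only [Pi.inv_apply]
  field_simp
  ring

/-- A constraint independent of t and x suffices: the Schwarz condition reduces to φ (μ ∂₁φ - φ ∂₂λ)
= 0, which the integrating factor solves. -/
theorem exists_isCompatibleConstraint_rectangle {I J : Set ℝ} (hI : IsOpen I)
    (hI' : I.OrdConnected) (hJ : IsOpen J) (hlam : ContDiffOn ℝ ∞ lam (rectangle I J))
    (hmu : ContDiffOn ℝ ∞ mu (rectangle I J)) (hmu0 : ∀ u ∈ rectangle I J, mu u ≠ 0)
    (h : ∀ u ∈ rectangle I J, grad lam u 0 = 0) :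
    ∃ φ : ℝ × ℝ × (Fin 2 → ℝ) → ℝ,
      IsCompatibleConstraint lam mu {w | w.2.2 ∈ rectangle I J} φ ∧
        ∀ w, w.2.2 ∈ rectangle I J → φ w ≠ 0 := by
  have hR := isOpen_rectangle hI hJ
  rcases I.eq_empty_or_nonempty with rfl | ⟨a, ha⟩
  · refine ⟨fun _ => 1, ⟨contDiffOn_const, fun w hw => ?_⟩, fun _ _ => one_ne_zero⟩
    exact absurd hw.1 (notMem_empty _)
  obtain ⟨φ, hφ, hφ0, hφ1, -⟩ := exists_integrating_factor hI hI' hJ ha hlam hmu hmu0 h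
  refine ⟨fun w => φ w.2.2, ⟨hφ.comp (by fun_prop) fun w hw => hw, fun w hw p => ?_⟩,
    fun w _ => (hφ0 _).ne'⟩
  have hφd := differentiableAt_of_contDiffOn hR hφ hw
  have hcomp : HasFDerivAt (fun z : ℝ × ℝ × (Fin 2 → ℝ) => φ z.2.2)
      ((fderiv ℝ φ w.2.2).comp ((ContinuousLinearMap.snd ℝ ℝ (Fin 2 → ℝ)).comp
        (ContinuousLinearMap.snd ℝ ℝ (ℝ × (Fin 2 → ℝ))))) w :=
    hφd.hasFDerivAt.comp w (hasFDerivAt_snd.comp w hasFDerivAt_snd)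
  rw [schwarz_iff hcomp.differentiableAt (differentiableAt_of_contDiffOn hR hlam hw), hcomp.fderiv]
  simp only [ContinuousLinearMap.comp_apply, ContinuousLinearMap.coe_snd', fderiv_fin_two,
    Matrix.cons_val_zero, Matrix.cons_val_one, h _ hw]
  linear_combination φ w.2.2 * hφ1 _ hw

/-- Every point of an open set of the plane has a rectangular neighbourhood inside it. -/
theorem exists_rectangle_subset (hΩ : IsOpen Ω) {u : Fin 2 → ℝ} (hu : u ∈ Ω) :
    ∃ I J : Set ℝ, IsOpen I ∧ I.OrdConnected ∧ IsOpen J ∧ J.OrdConnected ∧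
      u ∈ rectangle I J ∧ rectangle I J ⊆ Ω := by
  obtain ⟨ε, hε, hball⟩ := Metric.isOpen_iff.1 hΩ u hu
  refine ⟨Metric.ball (u 0) ε, Metric.ball (u 1) ε, Metric.isOpen_ball,
    (convex_ball _ _).ordConnected, Metric.isOpen_ball, (convex_ball _ _).ordConnected,
    ⟨Metric.mem_ball_self hε, Metric.mem_ball_self hε⟩, fun v hv => hball ?_⟩
  rw [Metric.mem_ball, dist_pi_lt_iff hε, Fin.forall_fin_two]
  exact hv

end Constraints

/-! ### Test functions on the line -/

section TestFunctions

/-- Smooth compactly supported functions on the line. -/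
def IsTestFunction (f : ℝ → ℝ) : Prop := ContDiff ℝ ∞ f ∧ HasCompactSupport f

theorem contDiff_deriv {E : Type*} [NormedAddCommGroup E] [NormedSpace ℝ E] {f : ℝ → E}
    (hf : ContDiff ℝ ∞ f) : ContDiff ℝ ∞ (deriv f) :=
  (contDiff_infty_iff_deriv.1 hf).2

theorem hasDerivAt_of_contDiff {E : Type*} [NormedAddCommGroup E] [NormedSpace ℝ E] {f : ℝ → E}
    (hf : ContDiff ℝ ∞ f) (x : ℝ) : HasDerivAt f (deriv f x) x :=
  (hf.differentiable (by simp) x).hasDerivAt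

variable {f g : ℝ → ℝ}

theorem IsTestFunction.integrable (hf : IsTestFunction f) : Integrable f :=
  hf.1.continuous.integrable_of_hasCompactSupport hf.2

theorem IsTestFunction.deriv (hf : IsTestFunction f) : IsTestFunction (deriv f) :=
  ⟨contDiff_deriv hf.1, hf.2.deriv⟩

theorem IsTestFunction.mul_left (hg : ContDiff ℝ ∞ g) (hf : IsTestFunction f) :
    IsTestFunction (fun x => g x * f x) :=
  ⟨hg.mul hf.1, hf.2.mul_left⟩

theorem IsTestFunction.mul_right (hf : IsTestFunction f) (hg : ContDiff ℝ ∞ g) :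
    IsTestFunction (fun x => f x * g x) :=
  ⟨hf.1.mul hg, hf.2.mul_right⟩

theorem IsTestFunction.add (hf : IsTestFunction f) (hg : IsTestFunction g) :
    IsTestFunction (fun x => f x + g x) :=
  ⟨hf.1.add hg.1, hf.2.add hg.2⟩

theorem isTestFunction_zero : IsTestFunction (fun _ => 0) :=
  ⟨contDiff_const, HasCompactSupport.zero⟩

theorem IsTestFunction.sum {ι : Type*} (s : Finset ι) {f : ι → ℝ → ℝ}
    (hf : ∀ i ∈ s, IsTestFunction (f i)) : IsTestFunction (fun x => ∑ i ∈ s, f i x) := by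
  classical
  induction s using Finset.induction_on with
  | empty => simpa using isTestFunction_zero
  | insert a s ha ih =>
    simp only [Finset.sum_insert ha]
    exact (hf a (by simp)).add (ih fun i hi => hf i (by simp [hi]))

theorem IsTestFunction.integral_deriv (hf : IsTestFunction f) : ∫ x, _root_.deriv f x = 0 :=
  integral_eq_zero_of_hasDerivAt_of_integrable (hasDerivAt_of_contDiff hf.1)
    hf.deriv.integrable hf.integrable

/-- A smooth compactly supported function equal to `1` near a given compact set. -/
theorem exists_cutoff {K : Set ℝ} (hK : IsCompact K) :
    ∃ c : ℝ → ℝ, IsTestFunction c ∧ ∀ x ∈ K, ∀ᶠ y in 𝓝 x, c y = 1 := by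
  obtain ⟨R, hR⟩ := hK.isBounded.subset_ball (0 : ℝ)
  let B : ContDiffBump (0 : ℝ) := ⟨max R 1, max R 1 + 1, by positivity, by linarith⟩
  refine ⟨B, ⟨B.contDiff, B.hasCompactSupport⟩, fun x hx => ?_⟩
  filter_upwards [Metric.isOpen_ball.mem_nhds (hR hx)] with y hy
  exact B.one_of_mem_closedBall
    (Metric.ball_subset_closedBall (Metric.ball_subset_ball (le_max_left _ _) hy))

theorem eq_zero_of_integral_mul_eq_zero (hf : Continuous f)
    (h : ∀ ψ, IsTestFunction ψ → ∫ x, ψ x * f x = 0) (x : ℝ) : f x = 0 := by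
  have hae := ae_eq_zero_of_integral_contDiff_smul_eq_zero (μ := volume)
    hf.locallyIntegrable fun ψ h1 h2 => by simpa using h ψ ⟨h1, h2⟩
  exact congrFun ((Continuous.ae_eq_iff_eq volume hf continuous_zero).1 hae) x

end TestFunctions

/-! ### Fields and covector fields along the line -/

section Fields

variable {n : ℕ} {V : Set (Fin n → ℝ)} {u v ψ χ : ℝ → Fin n → ℝ} {f : (Fin n → ℝ) → ℝ}

theorem deriv_apply (hv : ContDiff ℝ ∞ v) (x : ℝ) (i : Fin n) :
    HasDerivAt (fun y => v y i) (deriv v x i) x :=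
  hasDerivAt_pi.1 (hasDerivAt_of_contDiff hv x) i

theorem contDiff_apply_coord (hv : ContDiff ℝ ∞ v) (i : Fin n) :
    ContDiff ℝ ∞ (fun y => v y i) := contDiff_pi.1 hv i

theorem contDiff_deriv_apply (hv : ContDiff ℝ ∞ v) (i : Fin n) :
    ContDiff ℝ ∞ (fun y => deriv v y i) := contDiff_pi.1 (contDiff_deriv hv) i

theorem IsTestCovector.apply (hψ : IsTestCovector ψ) (i : Fin n) :
    IsTestFunction (fun x => ψ x i) :=
  ⟨contDiff_apply_coord hψ.1 i, hψ.2.comp_left (g := fun p : Fin n → ℝ => p i) rfl⟩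

theorem IsTestCovector.deriv_apply (hψ : IsTestCovector ψ) (i : Fin n) :
    IsTestFunction (fun x => deriv ψ x i) :=
  ⟨contDiff_deriv_apply hψ.1 i, hψ.2.deriv.comp_left (g := fun p : Fin n → ℝ => p i) rfl⟩

theorem isTestCovector_of_apply (h : ∀ i, IsTestFunction (fun x => ψ x i)) :
    IsTestCovector ψ := by
  refine ⟨contDiff_pi.2 fun i => (h i).1, ?_⟩
  refine HasCompactSupport.intro (isCompact_iUnion fun i => (h i).2) fun x hx => ?_
  ext i
  exact image_eq_zero_of_notMem_tsupport (f := fun x => ψ x i)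
    fun hx' => hx (mem_iUnion.2 ⟨i, hx'⟩)

theorem isTestCovector_single {ψ₀ : ℝ → ℝ} (h : IsTestFunction ψ₀) (i : Fin n) :
    IsTestCovector (fun x => Pi.single i (ψ₀ x)) := by
  refine isTestCovector_of_apply fun j => ?_
  by_cases hij : j = i
  · subst hij; simpa using h
  · simpa [hij] using isTestFunction_zero

theorem deriv_single {ψ₀ : ℝ → ℝ} (h : IsTestFunction ψ₀) (i : Fin n) (x : ℝ) :
    deriv (fun x => (Pi.single i (ψ₀ x) : Fin n → ℝ)) x = Pi.single i (deriv ψ₀ x) := by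
  refine HasDerivAt.deriv (hasDerivAt_pi.2 fun j => ?_)
  by_cases hij : j = i
  · subst hij; simpa using hasDerivAt_of_contDiff h.1 x
  · simpa [hij] using hasDerivAt_const x (0 : ℝ)

theorem IsFieldIn.contDiff_comp (hV : IsOpen V) (hu : IsFieldIn V u) {E : Type*}
    [NormedAddCommGroup E] [NormedSpace ℝ E] {f : (Fin n → ℝ) → E}
    (hf : ContDiffOn ℝ ∞ f V) : ContDiff ℝ ∞ (fun x => f (u x)) :=
  contDiff_iff_contDiffAt.2 fun x =>
    (hf.contDiffAt (hV.mem_nhds (hu.2 x))).comp x hu.1.contDiffAt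

theorem IsFieldIn.contDiff_fderiv (hV : IsOpen V) (hu : IsFieldIn V u)
    (hf : ContDiffOn ℝ ∞ f V) (hv : ContDiff ℝ ∞ v) :
    ContDiff ℝ ∞ (fun x => fderiv ℝ f (u x) (v x)) :=
  (hu.contDiff_comp hV (hf.fderiv_of_isOpen hV (by simp))).clm_apply hv

theorem IsFieldIn.hasDerivAt_comp (hV : IsOpen V) (hu : IsFieldIn V u)
    (hf : ContDiffOn ℝ ∞ f V) (x : ℝ) :
    HasDerivAt (fun y => f (u y)) (fderiv ℝ f (u x) (deriv u x)) x :=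
  (differentiableAt_of_contDiffOn hV hf (hu.2 x)).hasFDerivAt.comp_hasDerivAt x
    (hasDerivAt_of_contDiff hu.1 x)

theorem IsFieldIn.hasDerivAt_fderiv (hV : IsOpen V) (hu : IsFieldIn V u)
    (hf : ContDiffOn ℝ ∞ f V) (hv : ContDiff ℝ ∞ v) (x : ℝ) :
    HasDerivAt (fun y => fderiv ℝ f (u y) (v y))
      (fderiv ℝ (fderiv ℝ f) (u x) (deriv u x) (v x) + fderiv ℝ f (u x) (deriv v x)) x :=
  ((differentiableAt_of_contDiffOn hV (hf.fderiv_of_isOpen hV (by simp))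
    (hu.2 x)).hasFDerivAt.comp_hasDerivAt x (hasDerivAt_of_contDiff hu.1 x)).clm_apply
    (hasDerivAt_of_contDiff hv x)

/-- Fields through a given point along a line, with a bounded smooth profile. -/
theorem exists_isFieldIn_line (hV : IsOpen V) {u₀ : Fin n → ℝ} (hu₀ : u₀ ∈ V) (p : Fin n → ℝ)
    {s : ℝ → ℝ} (hs : ContDiff ℝ ∞ s) {C : ℝ} (hC : ∀ x, |s x| ≤ C) :
    ∃ δ : ℝ, 0 < δ ∧ IsFieldIn V (fun x => u₀ + (δ * s x) • p) := by
  obtain ⟨ε, hε, hball⟩ := Metric.isOpen_iff.1 hV u₀ hu₀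
  have hC0 : 0 ≤ C := (abs_nonneg _).trans (hC 0)
  have hD : 0 < C * ‖p‖ + 1 := by positivity
  -- The displacement has norm at most ε C‖p‖ / (C‖p‖ + 1) < ε; the added 1 keeps the denominator
  -- positive.
  refine ⟨ε / (C * ‖p‖ + 1), by positivity, by fun_prop, fun x => hball ?_⟩
  rw [Metric.mem_ball, dist_self_add_left, norm_smul, Real.norm_eq_abs, abs_mul,
    abs_of_pos (by positivity), div_mul_eq_mul_div, div_mul_eq_mul_div, div_lt_iff₀ hD, mul_assoc]
  have := mul_le_mul_of_nonneg_right (hC x) (norm_nonneg p)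
  gcongr
  linarith

theorem exists_isFieldIn_deriv (hV : IsOpen V) {u₀ : Fin n → ℝ} (hu₀ : u₀ ∈ V)
    (p : Fin n → ℝ) : ∃ (δ : ℝ) (u : ℝ → Fin n → ℝ), 0 < δ ∧ IsFieldIn V u ∧ u 0 = u₀ ∧
      deriv u 0 = δ • p := by
  obtain ⟨δ, hδ, h⟩ := exists_isFieldIn_line hV hu₀ p Real.contDiff_sin Real.abs_sin_le_one
  refine ⟨δ, _, hδ, h, by simp, ?_⟩
  have := (((Real.hasDerivAt_sin 0).const_mul δ).smul_const p).const_add u₀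
  simpa using this.deriv

theorem isFieldIn_const {u₀ : Fin n → ℝ} (hu₀ : u₀ ∈ V) : IsFieldIn V (fun _ => u₀) :=
  ⟨contDiff_const, fun _ => hu₀⟩

end Fields

/-! ### The operator and its linearization -/

section Operators

variable {n : ℕ} {V : Set (Fin n → ℝ)} {g : (Fin n → ℝ) → Matrix (Fin n) (Fin n) ℝ}
  {b : Fin n → Fin n → Fin n → (Fin n → ℝ) → ℝ} {u v ψ χ : ℝ → Fin n → ℝ}

theorem IsTestCovector.dotProduct (hχ : IsTestCovector χ) (hv : ContDiff ℝ ∞ v) :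
    IsTestFunction (fun x => χ x ⬝ᵥ v x) :=
  IsTestFunction.sum _ fun i _ => (hχ.apply i).mul_right (contDiff_apply_coord hv i)

theorem contDiff_dnOperator (hV : IsOpen V) (hg : ∀ i j, ContDiffOn ℝ ∞ (fun u => g u i j) V)
    (hb : ∀ i j k, ContDiffOn ℝ ∞ (b i j k) V) (hu : IsFieldIn V u) (hψ : ContDiff ℝ ∞ ψ) :
    ContDiff ℝ ∞ (dnOperator g b u ψ) :=
  contDiff_pi.2 fun i => (ContDiff.sum fun j _ =>
      (hu.contDiff_comp hV (hg i j)).mul (contDiff_deriv_apply hψ j)).add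
    (ContDiff.sum fun j _ => ContDiff.sum fun k _ =>
      ((hu.contDiff_comp hV (hb i j k)).mul (contDiff_deriv_apply hu.1 k)).mul
        (contDiff_apply_coord hψ j))

theorem isTestCovector_dnOperator (hV : IsOpen V)
    (hg : ∀ i j, ContDiffOn ℝ ∞ (fun u => g u i j) V)
    (hb : ∀ i j k, ContDiffOn ℝ ∞ (b i j k) V) (hu : IsFieldIn V u) (hψ : IsTestCovector ψ) :
    IsTestCovector (dnOperator g b u ψ) :=
  isTestCovector_of_apply fun i => (IsTestFunction.sum _ fun j _ =>
      (hψ.deriv_apply j).mul_left (hu.contDiff_comp hV (hg i j))).add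
    (IsTestFunction.sum _ fun j _ => IsTestFunction.sum _ fun k _ =>
      (hψ.apply j).mul_left
        ((hu.contDiff_comp hV (hb i j k)).mul (contDiff_deriv_apply hu.1 k)))

theorem deriv_add_smul (hu : ContDiff ℝ ∞ u) (hv : ContDiff ℝ ∞ v) (ε x : ℝ) :
    deriv (u + ε • v) x = deriv u x + ε • deriv v x :=
  ((hasDerivAt_of_contDiff hu x).add ((hasDerivAt_of_contDiff hv x).const_smul ε)).deriv

theorem hasDerivAt_line {V : Set (Fin n → ℝ)} {f : (Fin n → ℝ) → ℝ} (hV : IsOpen V)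
    (hf : ContDiffOn ℝ ∞ f V) {a : Fin n → ℝ} (ha : a ∈ V) (p : Fin n → ℝ) :
    HasDerivAt (fun ε : ℝ => f (a + ε • p)) (fderiv ℝ f a p) 0 := by
  have h1 : HasDerivAt (fun ε : ℝ => a + ε • p) p 0 := by
    simpa using ((hasDerivAt_id (0 : ℝ)).smul_const p).const_add a
  have h2 : HasFDerivAt f (fderiv ℝ f a) (a + (0 : ℝ) • p) := by
    simpa using (differentiableAt_of_contDiffOn hV hf ha).hasFDerivAt
  exact h2.comp_hasDerivAt 0 h1

theorem dnOperatorVariation_apply (hV : IsOpen V)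
    (hg : ∀ i j, ContDiffOn ℝ ∞ (fun u => g u i j) V)
    (hb : ∀ i j k, ContDiffOn ℝ ∞ (b i j k) V) (hu : IsFieldIn V u) (hv : ContDiff ℝ ∞ v)
    (x : ℝ) (i : Fin n) :
    dnOperatorVariation g b u v ψ x i =
      ∑ j, fderiv ℝ (fun w => g w i j) (u x) (v x) * deriv ψ x j +
      ∑ j, ∑ k, (fderiv ℝ (b i j k) (u x) (v x) * deriv u x k + b i j k (u x) * deriv v x k) *
        ψ x j := by
  refine HasDerivAt.deriv ?_
  simp only [dnOperator, deriv_add_smul hu.1 hv, Pi.add_apply, Pi.smul_apply, smul_eq_mul]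
  refine HasDerivAt.add (HasDerivAt.fun_sum fun j _ => ?_)
    (HasDerivAt.fun_sum fun j _ => HasDerivAt.fun_sum fun k _ => ?_)
  · exact (hasDerivAt_line hV (hg i j) (hu.2 x) (v x)).mul_const _
  · refine HasDerivAt.mul_const ?_ _
    have h1 := hasDerivAt_line hV (hb i j k) (hu.2 x) (v x)
    have h2 : HasDerivAt (fun ε : ℝ => deriv u x k + ε * deriv v x k) (deriv v x k) 0 := by
      simpa using ((hasDerivAt_id (0 : ℝ)).mul_const (deriv v x k)).const_add (deriv u x k)
    simpa using h1.fun_mul h2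

theorem contDiff_dnOperatorVariation (hV : IsOpen V)
    (hg : ∀ i j, ContDiffOn ℝ ∞ (fun u => g u i j) V)
    (hb : ∀ i j k, ContDiffOn ℝ ∞ (b i j k) V) (hu : IsFieldIn V u) (hv : ContDiff ℝ ∞ v)
    (hψ : ContDiff ℝ ∞ ψ) :
    ContDiff ℝ ∞ (dnOperatorVariation g b u v ψ) := by
  refine contDiff_pi.2 fun i => ?_
  simp only [dnOperatorVariation_apply hV hg hb hu hv]
  refine (ContDiff.sum fun j _ => ?_).add (ContDiff.sum fun j _ => ContDiff.sum fun k _ => ?_)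
  · exact (hu.contDiff_fderiv hV (hg i j) hv).mul (contDiff_deriv_apply hψ j)
  · exact (((hu.contDiff_fderiv hV (hb i j k) hv).mul (contDiff_deriv_apply hu.1 k)).add
      ((hu.contDiff_comp hV (hb i j k)).mul (contDiff_deriv_apply hv k))).mul
      (contDiff_apply_coord hψ j)

end Operators

/-! ### Consequences of skew-symmetry -/

section Skew

variable {n : ℕ} {V : Set (Fin n → ℝ)} {g : (Fin n → ℝ) → Matrix (Fin n) (Fin n) ℝ}
  {b : Fin n → Fin n → Fin n → (Fin n → ℝ) → ℝ} {u v ψ χ : ℝ → Fin n → ℝ}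

theorem dnOperator_single {ψ₀ : ℝ → ℝ} (h : IsTestFunction ψ₀) (i j : Fin n) (x : ℝ) :
    dnOperator g b u (fun x => Pi.single i (ψ₀ x)) x j =
      g (u x) j i * deriv ψ₀ x + (∑ k, b j i k (u x) * deriv u x k) * ψ₀ x := by
  simp only [dnOperator, deriv_single h, ← Finset.sum_mul]
  simp only [Pi.single_apply, mul_ite, mul_zero, Finset.sum_ite_eq', Finset.mem_univ, if_true]

/-- A skew-symmetric operator equals minus its formal adjoint. -/
theorem IsHamiltonianOperatorOn.dnOperator_eq (hV : IsOpen V)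
    (H : IsHamiltonianOperatorOn V g b) (hu : IsFieldIn V u) (hχ : IsTestCovector χ) (x : ℝ)
    (i : Fin n) :
    dnOperator g b u χ x i = deriv (fun y => ∑ j, χ y j * g (u y) j i) x -
      ∑ j, χ x j * ∑ k, b j i k (u x) * deriv u x k := by
  have hP := contDiff_dnOperator hV H.smooth_g H.smooth_b hu hχ.1
  have hG : IsTestFunction (fun y => ∑ j, χ y j * g (u y) j i) :=
    IsTestFunction.sum _ fun j _ => (hχ.apply j).mul_right (hu.contDiff_comp hV (H.smooth_g j i))
  have hB : ContDiff ℝ ∞ (fun y => ∑ j, χ y j * ∑ k, b j i k (u y) * deriv u y k) :=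
    ContDiff.sum fun j _ => (hχ.apply j).1.mul <| ContDiff.sum fun k _ =>
      (hu.contDiff_comp hV (H.smooth_b j i k)).mul (contDiff_deriv_apply hu.1 k)
  have key := eq_zero_of_integral_mul_eq_zero
    (((contDiff_apply_coord hP i).sub (contDiff_deriv hG.1)).add hB).continuous ?_ x
  · linarith
  intro ψ₀ hψ₀
  have hψ := isTestCovector_single hψ₀ i
  have hPψ := contDiff_dnOperator hV H.smooth_g H.smooth_b hu hψ.1
  have hs := H.skew u hu _ χ hψ hχ
  have hGψ : IsTestFunction (fun y => ψ₀ y * ∑ j, χ y j * g (u y) j i) := hψ₀.mul_right hG.1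
  -- Tested against ψ₀, the defect is the symmetrized bracket density, whose integral vanishes by
  -- skew-symmetry, minus a total derivative.
  have h1 : ∀ y, ψ₀ y * (dnOperator g b u χ y i - deriv (fun y => ∑ j, χ y j * g (u y) j i) y +
      ∑ j, χ y j * ∑ k, b j i k (u y) * deriv u y k) =
      ((fun x => Pi.single i (ψ₀ x)) y ⬝ᵥ dnOperator g b u χ y +
        χ y ⬝ᵥ dnOperator g b u (fun x => Pi.single i (ψ₀ x)) y) -
        deriv (fun y => ψ₀ y * ∑ j, χ y j * g (u y) j i) y := by
    intro y
    rw [((hasDerivAt_of_contDiff hψ₀.1 y).fun_mul (hasDerivAt_of_contDiff hG.1 y)).deriv]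
    have e : χ y ⬝ᵥ dnOperator g b u (fun x => Pi.single i (ψ₀ x)) y =
        (∑ j, χ y j * g (u y) j i) * deriv ψ₀ y +
          ψ₀ y * ∑ j, χ y j * ∑ k, b j i k (u y) * deriv u y k := by
      rw [Finset.sum_mul, Finset.mul_sum, ← Finset.sum_add_distrib]
      refine Finset.sum_congr rfl fun j _ => ?_
      rw [dnOperator_single hψ₀]
      ring
    rw [e, single_dotProduct]
    ring
  simp only [h1]
  rw [integral_sub, integral_add, hs, hGψ.integral_deriv]
  · ring
  · exact (hψ.dotProduct hP).integrable
  · exact (hχ.dotProduct hPψ).integrable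
  · exact ((hψ.dotProduct hP).add (hχ.dotProduct hPψ)).integrable
  · exact hGψ.deriv.integrable

/-- On a constant field only the g ∂_x terms of P and of minus its adjoint survive; a test function
equal to x near 0 compares their coefficients. -/
theorem IsHamiltonianOperatorOn.symm (hV : IsOpen V) (H : IsHamiltonianOperatorOn V g b)
    {u₀ : Fin n → ℝ} (hu₀ : u₀ ∈ V) (i j : Fin n) : g u₀ i j = g u₀ j i := by
  obtain ⟨c, hc, hc1⟩ := exists_cutoff (isCompact_singleton (x := (0 : ℝ)))
  have hc0 : c 0 = 1 := (hc1 0 rfl).self_of_nhds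
  have hχ₀ : IsTestFunction (fun x => x * c x) := hc.mul_left contDiff_id
  have hd : HasDerivAt (fun x => x * c x) 1 0 := by
    simpa [hc0] using (hasDerivAt_id' (0 : ℝ)).fun_mul (hasDerivAt_of_contDiff hc.1 0)
  have h := H.dnOperator_eq hV (isFieldIn_const hu₀) (isTestCovector_single hχ₀ j) 0 i
  rw [dnOperator_single hχ₀] at h
  have hd' := (hd.mul_const (g u₀ j i)).deriv
  simpa [Pi.single_apply, hd.deriv, hd'] using h

/-- Comparison of the zeroth-order terms of P and minus its adjoint: the test function is 1 near 0,
and the field has derivative proportional to the k-th basis vector there. -/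
theorem IsHamiltonianOperatorOn.grad_eq (hV : IsOpen V) (H : IsHamiltonianOperatorOn V g b)
    {u₀ : Fin n → ℝ} (hu₀ : u₀ ∈ V) (i j k : Fin n) :
    grad (fun w => g w j i) u₀ k = b i j k u₀ + b j i k u₀ := by
  obtain ⟨c, hc, hc1⟩ := exists_cutoff (isCompact_singleton (x := (0 : ℝ)))
  have hc0 : c 0 = 1 := (hc1 0 rfl).self_of_nhds
  have hcd : deriv c 0 = 0 := by
    have : c =ᶠ[𝓝 0] fun _ => 1 := hc1 0 rfl
    rw [this.deriv_eq, deriv_const]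
  obtain ⟨δ, u, hδ, hu, hu0, hu'⟩ := exists_isFieldIn_deriv hV hu₀ (Pi.single k 1)
  have h := H.dnOperator_eq hV hu (isTestCovector_single hc j) 0 i
  have hd := ((hasDerivAt_of_contDiff hc.1 0).fun_mul
    (hu.hasDerivAt_comp hV (H.smooth_g j i) 0)).deriv
  rw [dnOperator_single hc] at h
  simp [Pi.single_apply, hd, hcd, hc0, hu0, hu'] at h
  have h2 : δ * grad (fun w => g w j i) u₀ k = δ * (b i j k u₀ + b j i k u₀) := by
    rw [grad]; linarith
  exact mul_left_cancel₀ hδ.ne' h2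

end Skew

/-! ### Linearizing the Hamiltonian representation -/

section Energy

variable {n : ℕ} {V : Set (Fin n → ℝ)} {A g : (Fin n → ℝ) → Matrix (Fin n) (Fin n) ℝ}
  {b : Fin n → Fin n → Fin n → (Fin n → ℝ) → ℝ} {h : (Fin n → ℝ) → ℝ}
  {u v w η ψ χ : ℝ → Fin n → ℝ}

/-- The Hamiltonian representation `A u_x = P (∂h/∂u)` written for the coefficients. -/
theorem coefficient_eq_of_hamiltonian (hV : IsOpen V) (hh : ContDiffOn ℝ ∞ h V)
    (hA : ∀ u, IsFieldIn V u → ∀ x,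
      Matrix.mulVec (A (u x)) (deriv u x) = dnOperator g b u (fun y => grad h (u y)) x)
    {u₀ : Fin n → ℝ} (hu₀ : u₀ ∈ V) (i k : Fin n) :
    A u₀ i k = ∑ j, (g u₀ i j * grad (fun w => grad h w j) u₀ k + b i j k u₀ * grad h u₀ j) := by
  obtain ⟨δ, u, hδ, hu, hu0, hu'⟩ := exists_isFieldIn_deriv hV hu₀ (Pi.single k 1)
  have h1 := congrFun (hA u hu 0) i
  have h2 : ∀ j, deriv (fun y => grad h (u y)) 0 j = δ * grad (fun w => grad h w j) u₀ k := by
    intro j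
    have hs := deriv_apply (contDiff_pi.2 fun j =>
      hu.contDiff_comp hV (contDiffOn_grad hV hh j)) 0 j
    rw [hs.unique (hu.hasDerivAt_comp hV (contDiffOn_grad hV hh j) 0), hu', hu0]
    simp [grad]
  simp [dnOperator, h2, hu', hu0, Matrix.mulVec_smul, Pi.single_apply] at h1
  refine mul_left_cancel₀ hδ.ne' ?_
  rw [h1, Finset.sum_add_distrib, mul_add, Finset.mul_sum, Finset.mul_sum]
  congr 1 <;> refine Finset.sum_congr rfl fun j _ => ?_ <;> ring

/-- The linearization of `u ↦ A(u) u_x` at the field `u` in the direction `w`. -/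
noncomputable def fluxVariation (A : (Fin n → ℝ) → Matrix (Fin n) (Fin n) ℝ)
    (u w : ℝ → Fin n → ℝ) (x : ℝ) : Fin n → ℝ :=
  fun i => ∑ k, (fderiv ℝ (fun y => A y i k) (u x) (w x) * deriv u x k +
    A (u x) i k * deriv w x k)

theorem contDiff_fluxVariation (hV : IsOpen V) (hA : ∀ i j, ContDiffOn ℝ ∞ (fun u => A u i j) V)
    (hu : IsFieldIn V u) (hw : ContDiff ℝ ∞ w) : ContDiff ℝ ∞ (fluxVariation A u w) :=
  contDiff_pi.2 fun i => ContDiff.sum fun k _ =>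
    ((hu.contDiff_fderiv hV (hA i k) hw).mul (contDiff_deriv_apply hu.1 k)).add
      ((hu.contDiff_comp hV (hA i k)).mul (contDiff_deriv_apply hw k))

/-- The Hessian of `h` along the field `u`, applied to the vector field `w`. -/
noncomputable def hessianAlong (h : (Fin n → ℝ) → ℝ) (u w : ℝ → Fin n → ℝ) (x : ℝ) :
    Fin n → ℝ :=
  fun j => fderiv ℝ (fun y => grad h y j) (u x) (w x)

theorem contDiff_hessianAlong (hV : IsOpen V) (hh : ContDiffOn ℝ ∞ h V)
    (hu : IsFieldIn V u) (hw : ContDiff ℝ ∞ w) : ContDiff ℝ ∞ (hessianAlong h u w) :=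
  contDiff_pi.2 fun j => hu.contDiff_fderiv hV (contDiffOn_grad hV hh j) hw

theorem isTestCovector_hessianAlong (hV : IsOpen V) (hh : ContDiffOn ℝ ∞ h V)
    (hu : IsFieldIn V u) (hw : IsTestCovector w) : IsTestCovector (hessianAlong h u w) := by
  refine isTestCovector_of_apply fun j => ?_
  have : (fun x => hessianAlong h u w x j) =
      fun x => ∑ l, grad (fun y => grad h y j) (u x) l * w x l := by
    ext x; rw [sum_grad_mul]; rfl
  rw [this]
  exact IsTestFunction.sum _ fun l _ => (hw.apply l).mul_left
    (hu.contDiff_comp hV (contDiffOn_grad hV (contDiffOn_grad hV hh j) l))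

theorem hessianAlong_dotProduct_comm (hV : IsOpen V) (hh : ContDiffOn ℝ ∞ h V)
    (hu : IsFieldIn V u) (x : ℝ) :
    hessianAlong h u v x ⬝ᵥ w x = hessianAlong h u w x ⬝ᵥ v x := by
  simp only [hessianAlong, dotProduct, ← sum_grad_mul, Finset.sum_mul]
  rw [Finset.sum_comm]
  refine Finset.sum_congr rfl fun j _ => Finset.sum_congr rfl fun l _ => ?_
  rw [grad_grad_comm hV hh (hu.2 x)]
  ring

theorem sum_fderiv_grad_mul {f : (Fin n → ℝ) → ℝ} (hV : IsOpen V) (hf : ContDiffOn ℝ ∞ f V)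
    {a : Fin n → ℝ} (ha : a ∈ V) (p q : Fin n → ℝ) :
    ∑ k, fderiv ℝ (fun v => grad f v k) a p * q k = fderiv ℝ (fderiv ℝ f) a q p := by
  rw [fderiv_fderiv_comm hV hf ha, ← fderiv_fderiv_apply hV hf ha]
  have : (fun v => fderiv ℝ f v q) = fun v => ∑ k, grad f v k * q k := by
    ext v; rw [sum_grad_mul]
  rw [this]
  have hd : HasFDerivAt (fun v => ∑ k, grad f v k * q k) _ a :=
    HasFDerivAt.fun_sum fun k _ => (differentiableAt_of_contDiffOn hV
      (contDiffOn_grad hV hf k) ha).hasFDerivAt.mul_const (q k)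
  rw [hd.fderiv]
  simp only [sum_apply, smul_apply, smul_eq_mul]
  exact Finset.sum_congr rfl fun k _ => mul_comm _ _

/-- Linearizing `P (∂h/∂u) = A u_x` in the direction `w`. -/
theorem dnOperatorVariation_grad (hV : IsOpen V)
    (hg : ∀ i j, ContDiffOn ℝ ∞ (fun u => g u i j) V)
    (hb : ∀ i j k, ContDiffOn ℝ ∞ (b i j k) V) (hh : ContDiffOn ℝ ∞ h V)
    (hA : ∀ u ∈ V, ∀ i k,
      A u i k = ∑ j, (g u i j * grad (fun w => grad h w j) u k + b i j k u * grad h u j))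
    (hu : IsFieldIn V u) (hw : ContDiff ℝ ∞ w) {x : ℝ}
    (hη : η =ᶠ[𝓝 x] fun y => grad h (u y)) (i : Fin n) :
    dnOperatorVariation g b u w η x i =
      fluxVariation A u w x i - dnOperator g b u (hessianAlong h u w) x i := by
  have hhj := fun j => contDiffOn_grad hV hh j
  have hη0 : η x = grad h (u x) := hη.self_of_nhds
  have hη1 : ∀ j, deriv η x j = fderiv ℝ (fun y => grad h y j) (u x) (deriv u x) := by
    intro j
    rw [hη.deriv_eq]
    exact (deriv_apply (contDiff_pi.2 fun j => hu.contDiff_comp hV (hhj j)) x j).unique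
      (hu.hasDerivAt_comp hV (hhj j) x)
  have hH : ∀ j, deriv (hessianAlong h u w) x j =
      fderiv ℝ (fderiv ℝ (fun y => grad h y j)) (u x) (deriv u x) (w x) +
        fderiv ℝ (fun y => grad h y j) (u x) (deriv w x) := fun j =>
    (deriv_apply (contDiff_hessianAlong hV hh hu hw) x j).unique
      (hu.hasDerivAt_fderiv hV (hhj j) hw x)
  have hdA : ∀ k, fderiv ℝ (fun y => A y i k) (u x) (w x) = ∑ j,
      (fderiv ℝ (fun y => g y i j) (u x) (w x) * grad (fun w => grad h w j) (u x) k +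
        g (u x) i j * fderiv ℝ (fun v => grad (fun w => grad h w j) v k) (u x) (w x) +
        (fderiv ℝ (b i j k) (u x) (w x) * grad h (u x) j +
        b i j k (u x) * fderiv ℝ (fun y => grad h y j) (u x) (w x))) := by
    intro k
    have e : (fun y => A y i k) =ᶠ[𝓝 (u x)] fun y =>
        ∑ j, (g y i j * grad (fun w => grad h w j) y k + b i j k y * grad h y j) := by
      filter_upwards [hV.mem_nhds (hu.2 x)] with y hy using hA y hy i k
    rw [e.fderiv_eq]
    have hd : HasFDerivAt (fun y =>
        ∑ j, (g y i j * grad (fun w => grad h w j) y k + b i j k y * grad h y j)) _ (u x) :=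
      HasFDerivAt.fun_sum fun j _ =>
      ((differentiableAt_of_contDiffOn hV (hg i j) (hu.2 x)).hasFDerivAt.mul
        (differentiableAt_of_contDiffOn hV (contDiffOn_grad hV (hhj j) k)
          (hu.2 x)).hasFDerivAt).add
      ((differentiableAt_of_contDiffOn hV (hb i j k) (hu.2 x)).hasFDerivAt.mul
        (differentiableAt_of_contDiffOn hV (hhj j) (hu.2 x)).hasFDerivAt)
    rw [hd.fderiv]
    simp only [sum_apply, add_apply, smul_apply, smul_eq_mul]
    refine Finset.sum_congr rfl fun j _ => ?_
    ring
  -- The third derivatives of h from differentiating the coefficients A are matched with those in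
  -- ∂_x of the Hessian term.
  have hD2 := fun j => sum_fderiv_grad_mul hV (hhj j) (hu.2 x) (w x) (deriv u x)
  have hflux : fluxVariation A u w x i = ∑ j, ∑ k,
      ((fderiv ℝ (fun y => g y i j) (u x) (w x) * grad (fun w => grad h w j) (u x) k +
        g (u x) i j * fderiv ℝ (fun v => grad (fun w => grad h w j) v k) (u x) (w x) +
        (fderiv ℝ (b i j k) (u x) (w x) * grad h (u x) j +
        b i j k (u x) * fderiv ℝ (fun y => grad h y j) (u x) (w x))) * deriv u x k +
      (g (u x) i j * grad (fun w => grad h w j) (u x) k + b i j k (u x) * grad h (u x) j) *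
        deriv w x k) := by
    simp only [fluxVariation, hdA, hA (u x) (hu.2 x), Finset.sum_mul, ← Finset.sum_add_distrib]
    exact Finset.sum_comm
  rw [dnOperatorVariation_apply hV hg hb hu hw, hflux, eq_sub_iff_add_eq]
  simp only [dnOperator, hη0, hη1, hH, ← hD2, ← Finset.sum_add_distrib]
  refine Finset.sum_congr rfl fun j _ => ?_
  rw [← sum_grad_mul (fun y => grad h y j) _ (deriv u x),
    ← sum_grad_mul (fun y => grad h y j) _ (deriv w x)]
  simp only [Finset.mul_sum, ← Finset.sum_add_distrib]
  refine Finset.sum_congr rfl fun k _ => ?_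
  simp only [hessianAlong]
  ring

end Energy

/-! ### Invariance of the operator under the flow -/

section Invariance

variable {n : ℕ} {V : Set (Fin n → ℝ)} {A g : (Fin n → ℝ) → Matrix (Fin n) (Fin n) ℝ}
  {b : Fin n → Fin n → Fin n → (Fin n → ℝ) → ℝ} {h : (Fin n → ℝ) → ℝ}
  {u v w z η ψ χ : ℝ → Fin n → ℝ}

theorem fderiv_congr_of_isOpen {f₁ f₂ : (Fin n → ℝ) → ℝ} (hV : IsOpen V)
    (hf : ∀ u ∈ V, f₁ u = f₂ u) {a : Fin n → ℝ} (ha : a ∈ V) : fderiv ℝ f₁ a = fderiv ℝ f₂ a :=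
  Filter.EventuallyEq.fderiv_eq (by filter_upwards [hV.mem_nhds ha] with v hv using hf v hv)

/-- The linearization of a skew-symmetric operator is skew-symmetric up to a total derivative. -/
theorem IsHamiltonianOperatorOn.dotProduct_variation_add (hV : IsOpen V)
    (H : IsHamiltonianOperatorOn V g b) (hu : IsFieldIn V u) (hz : ContDiff ℝ ∞ z)
    (hη : ContDiff ℝ ∞ η) (hψ : ContDiff ℝ ∞ ψ) (x : ℝ) :
    η x ⬝ᵥ dnOperatorVariation g b u z ψ x + ψ x ⬝ᵥ dnOperatorVariation g b u z η x =
      deriv (fun y => ∑ i, ∑ j, fderiv ℝ (fun w => g w i j) (u y) (z y) * (η y i * ψ y j)) x := by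
  have hG : ∀ i j, fderiv ℝ (fun w => g w i j) (u x) = fderiv ℝ (fun w => g w j i) (u x) :=
    fun i j => fderiv_congr_of_isOpen hV (fun w hw => H.symm hV hw i j) (hu.2 x)
  -- Derivative along z of the relation ∂ₖg^{ij} = b^{ij}_k + b^{ji}_k.
  have hB : ∀ i j k, fderiv ℝ (fun y => grad (fun w => g w i j) y k) (u x) (z x) =
      fderiv ℝ (b i j k) (u x) (z x) + fderiv ℝ (b j i k) (u x) (z x) := by
    intro i j k
    rw [fderiv_congr_of_isOpen hV (f₂ := fun w => b j i k w + b i j k w)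
      (fun w hw => H.grad_eq hV hw j i k) (hu.2 x),
      fderiv_fun_add (differentiableAt_of_contDiffOn hV (H.smooth_b j i k) (hu.2 x))
        (differentiableAt_of_contDiffOn hV (H.smooth_b i j k) (hu.2 x)), add_apply, add_comm]
  have hd : HasDerivAt
      (fun y => ∑ i, ∑ j, fderiv ℝ (fun w => g w i j) (u y) (z y) * (η y i * ψ y j)) _ x :=
    HasDerivAt.fun_sum fun i _ => HasDerivAt.fun_sum fun j _ =>
      (hu.hasDerivAt_fderiv hV (H.smooth_g i j) hz x).fun_mul
        ((deriv_apply hη x i).fun_mul (deriv_apply hψ x j))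
  have e : ∀ η ψ : ℝ → Fin n → ℝ, η x ⬝ᵥ dnOperatorVariation g b u z ψ x =
      ∑ i, ∑ j, (fderiv ℝ (fun w => g w i j) (u x) (z x) * (η x i * deriv ψ x j) +
        (∑ k, (fderiv ℝ (b i j k) (u x) (z x) * deriv u x k + b i j k (u x) * deriv z x k)) *
          (η x i * ψ x j)) := by
    intro η ψ
    refine Finset.sum_congr rfl fun i _ => ?_
    rw [dnOperatorVariation_apply hV H.smooth_g H.smooth_b hu hz, ← Finset.sum_add_distrib,
      Finset.mul_sum]
    refine Finset.sum_congr rfl fun j _ => ?_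
    rw [← Finset.sum_mul]
    ring
  rw [hd.deriv, e, e ψ η]
  conv_lhs => arg 2; rw [Finset.sum_comm]
  rw [← Finset.sum_add_distrib]
  refine Finset.sum_congr rfl fun i _ => ?_
  rw [← Finset.sum_add_distrib]
  refine Finset.sum_congr rfl fun j _ => ?_
  rw [hG j i, ← sum_fderiv_grad_mul hV (H.smooth_g i j) (hu.2 x),
    ← sum_grad_mul (fun w => g w i j) _ (deriv z x)]
  simp only [hB, H.grad_eq hV (hu.2 x) j i, add_mul, Finset.sum_add_distrib]
  ring

/-- The flow of a Hamiltonian system preserves the Hamiltonian operator: the Lie derivative of `P`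
along `A u_x` vanishes. -/
theorem IsHamiltonianOperatorOn.lieDerivative_eq_zero (hV : IsOpen V)
    (H : IsHamiltonianOperatorOn V g b) (hAs : ∀ i j, ContDiffOn ℝ ∞ (fun u => A u i j) V)
    (hh : ContDiffOn ℝ ∞ h V)
    (hA : ∀ u, IsFieldIn V u → ∀ x,
      Matrix.mulVec (A (u x)) (deriv u x) = dnOperator g b u (fun y => grad h (u y)) x)
    (hu : IsFieldIn V u) (hψ : IsTestCovector ψ) (hχ : IsTestCovector χ) :
    (∫ x, ψ x ⬝ᵥ dnOperatorVariation g b u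
        (fun y => Matrix.mulVec (A (u y)) (deriv u y)) χ x) +
      (∫ x, χ x ⬝ᵥ fluxVariation A u (dnOperator g b u ψ) x) -
      (∫ x, ψ x ⬝ᵥ fluxVariation A u (dnOperator g b u χ) x) = 0 := by
  -- The Jacobi identity is available only for compactly supported covectors, so ∂h/∂u is cut off
  -- outside a neighbourhood of the supports of ψ and χ. There P η = A u_x, and the integrands
  -- vanish elsewhere.
  obtain ⟨c, hc, hc1⟩ := exists_cutoff (hψ.2.isCompact.union hχ.2.isCompact)
  have hgrad : ContDiff ℝ ∞ (fun y => grad h (u y)) :=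
    contDiff_pi.2 fun j => hu.contDiff_comp hV (contDiffOn_grad hV hh j)
  let η : ℝ → Fin n → ℝ := fun y => c y • grad h (u y)
  have hη : IsTestCovector η := ⟨hc.1.smul hgrad, hc.2.smul_right⟩
  have hη1 : ∀ x ∈ tsupport ψ ∪ tsupport χ, η =ᶠ[𝓝 x] fun y => grad h (u y) := by
    intro x hx
    filter_upwards [hc1 x hx] with y hy
    simp [η, hy]
  have hcoef := fun (v : Fin n → ℝ) (hv : v ∈ V) (i k : Fin n) =>
    coefficient_eq_of_hamiltonian hV hh hA hv i k
  have hPt : ∀ {ψ : ℝ → Fin n → ℝ}, IsTestCovector ψ → IsTestCovector (dnOperator g b u ψ) :=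
    fun hψ => isTestCovector_dnOperator hV H.smooth_g H.smooth_b hu hψ
  have hPc : ∀ {ψ : ℝ → Fin n → ℝ}, ContDiff ℝ ∞ ψ → ContDiff ℝ ∞ (dnOperator g b u ψ) :=
    fun hψ => contDiff_dnOperator hV H.smooth_g H.smooth_b hu hψ
  have hHt : ∀ {ψ : ℝ → Fin n → ℝ}, IsTestCovector ψ →
      IsTestCovector (hessianAlong h u (dnOperator g b u ψ)) :=
    fun hψ => isTestCovector_hessianAlong hV hh hu (hPt hψ)
  have hvar : ∀ {ψ χ : ℝ → Fin n → ℝ}, IsTestCovector ψ → IsTestCovector χ →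
      (∀ x ∈ tsupport χ, η =ᶠ[𝓝 x] fun y => grad h (u y)) →
      ∫ x, χ x ⬝ᵥ dnOperatorVariation g b u (dnOperator g b u ψ) η x =
        (∫ x, χ x ⬝ᵥ fluxVariation A u (dnOperator g b u ψ) x) -
          ∫ x, χ x ⬝ᵥ dnOperator g b u (hessianAlong h u (dnOperator g b u ψ)) x := by
    intro ψ χ hψ hχ hηχ
    rw [← integral_sub]
    · refine integral_congr_ae (Eventually.of_forall fun x => ?_)
      by_cases hx : x ∈ tsupport χ
      · beta_reduce
        rw [← dotProduct_sub]
        congr 1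
        ext i
        exact dnOperatorVariation_grad hV H.smooth_g H.smooth_b hh hcoef hu (hPt hψ).1
          (hηχ x hx) i
      · simp [image_eq_zero_of_notMem_tsupport hx]
    · exact (hχ.dotProduct (contDiff_fluxVariation hV hAs hu (hPt hψ).1)).integrable
    · exact (hχ.dotProduct (hPc (hHt hψ).1)).integrable
  have T1 : ∫ x, ψ x ⬝ᵥ dnOperatorVariation g b u (dnOperator g b u η) χ x =
      ∫ x, ψ x ⬝ᵥ dnOperatorVariation g b u
        (fun y => Matrix.mulVec (A (u y)) (deriv u y)) χ x := by
    refine integral_congr_ae (Eventually.of_forall fun x => ?_)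
    by_cases hx : x ∈ tsupport ψ
    · have hev : dnOperator g b u η =ᶠ[𝓝 x] fun y => Matrix.mulVec (A (u y)) (deriv u y) := by
        filter_upwards [(hη1 x (Or.inl hx)).eventuallyEq_nhds] with y hy
        rw [hA u hu y]
        ext i
        simp only [dnOperator, hy.deriv_eq, hy.self_of_nhds]
      have hAu : ContDiff ℝ ∞ (fun y => Matrix.mulVec (A (u y)) (deriv u y)) := by
        simp only [hA u hu]
        exact hPc hgrad
      beta_reduce
      congr 1
      ext i
      rw [dnOperatorVariation_apply hV H.smooth_g H.smooth_b hu hAu,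
        dnOperatorVariation_apply hV H.smooth_g H.smooth_b hu (hPt hη).1, hev.deriv_eq,
        hev.self_of_nhds]
    · simp [image_eq_zero_of_notMem_tsupport hx]
  have T2 := hvar hψ hχ fun x hx => hη1 x (Or.inr hx)
  -- The linearized operator is moved from ψ onto η, so that `hvar` applies to this term as well.
  have T3 : ∫ x, η x ⬝ᵥ dnOperatorVariation g b u (dnOperator g b u χ) ψ x =
      -∫ x, ψ x ⬝ᵥ dnOperatorVariation g b u (dnOperator g b u χ) η x := by
    rw [eq_neg_iff_add_eq_zero, ← integral_add]
    · simp only [H.dotProduct_variation_add hV hu (hPt hχ).1 hη.1 hψ.1]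
      refine IsTestFunction.integral_deriv (IsTestFunction.sum _ fun i _ =>
        IsTestFunction.sum _ fun j _ => IsTestFunction.mul_left
          (hu.contDiff_fderiv hV (H.smooth_g i j) (hPt hχ).1)
          ((hη.apply i).mul_right (hψ.apply j).1))
    · exact (hη.dotProduct (contDiff_dnOperatorVariation hV H.smooth_g H.smooth_b hu
        (hPt hχ).1 hψ.1)).integrable
    · exact (hψ.dotProduct (contDiff_dnOperatorVariation hV H.smooth_g H.smooth_b hu
        (hPt hχ).1 hη.1)).integrable
  have T3' := hvar hχ hψ fun x hx => hη1 x (Or.inl hx)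
  have hJ := H.jacobi u hu ψ χ η hψ hχ hη
  have s1 := H.skew u hu _ _ hχ (hHt hψ)
  have s2 := H.skew u hu _ _ hψ (hHt hχ)
  -- The two Hessian terms cancel, by skew-symmetry of P and symmetry of the Hessian of h.
  have s3 : ∫ x, hessianAlong h u (dnOperator g b u ψ) x ⬝ᵥ dnOperator g b u χ x =
      ∫ x, hessianAlong h u (dnOperator g b u χ) x ⬝ᵥ dnOperator g b u ψ x :=
    integral_congr_ae (Eventually.of_forall fun x => hessianAlong_dotProduct_comm hV hh hu x)
  rw [T1, T2, T3, T3', s1, s2, s3] at hJ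
  linarith

end Invariance

/-! ### Hamiltonian systems are linearly degenerate -/

section Necessity

theorem integral_eq_zero_of_eq_add_deriv {f p q : ℝ → ℝ} (hp : Integrable p)
    (hp0 : ∫ x, p x = 0) (hq : IsTestFunction q) (h : ∀ x, f x = p x + deriv q x) :
    ∫ x, f x = 0 := by
  simp only [h]
  rw [integral_add hp hq.deriv.integrable, hp0, hq.integral_deriv, add_zero]

variable {V : Set (Fin 2 → ℝ)} {lam mu h : (Fin 2 → ℝ) → ℝ}
  {g : (Fin 2 → ℝ) → Matrix (Fin 2) (Fin 2) ℝ}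
  {b : Fin 2 → Fin 2 → Fin 2 → (Fin 2 → ℝ) → ℝ}

theorem contDiffOn_jordanBlock (hlam : ContDiffOn ℝ ∞ lam V) (hmu : ContDiffOn ℝ ∞ mu V)
    (i j : Fin 2) : ContDiffOn ℝ ∞ (fun u => jordanBlock lam mu u i j) V := by
  fin_cases i <;> fin_cases j
  · exact hlam
  · exact hmu
  · exact contDiffOn_const
  · exact hlam

/-- On a constant field the invariance of P reads ∫ (χ · A g ψ'' - ψ · A g χ'') = 0, so A g is
symmetric; its off-diagonal entries differ by μ g²². -/
theorem IsHamiltonianOperatorOn.metric_eq_zero (hV : IsOpen V)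
    (H : IsHamiltonianOperatorOn V g b) (hlam : ContDiffOn ℝ ∞ lam V)
    (hmu : ContDiffOn ℝ ∞ mu V) (hmu0 : ∀ u ∈ V, mu u ≠ 0) (hh : ContDiffOn ℝ ∞ h V)
    (hA : ∀ u, IsFieldIn V u → ∀ x, Matrix.mulVec (jordanBlock lam mu (u x)) (deriv u x) =
      dnOperator g b u (fun y => grad h (u y)) x)
    {u₀ : Fin 2 → ℝ} (hu₀ : u₀ ∈ V) : g u₀ 1 1 = 0 := by
  have hu := isFieldIn_const hu₀
  obtain ⟨c, hc, hc1⟩ := exists_cutoff (isCompact_singleton (x := (0 : ℝ)))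
  -- The factor x² makes the second derivative at 0 equal to 2, so the coefficient can be read off
  -- there.
  have hψ₀ : IsTestFunction (fun x => x ^ 2 * c x) := hc.mul_left (by fun_prop)
  have hψ₂ : deriv (deriv (fun x => x ^ 2 * c x)) 0 = 2 := by
    have : (fun x => x ^ 2 * c x) =ᶠ[𝓝 0] fun x => x ^ 2 := by
      filter_upwards [hc1 0 rfl] with y hy
      rw [hy, mul_one]
    rw [this.deriv.deriv_eq]
    have : deriv (fun x : ℝ => x ^ 2) = fun x => 2 * x := by ext x; simp
    rw [this]
    simp
  generalize (fun x => x ^ 2 * c x) = ψ₀ at hψ₀ hψ₂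
  have hP : ∀ {f : ℝ → ℝ}, IsTestFunction f → ∀ i,
      dnOperator g b (fun _ => u₀) (fun x => Pi.single i (f x)) =
        fun x l => g u₀ l i * deriv f x := by
    intro f hf i
    ext x l
    rw [dnOperator_single hf]
    simp
  have hF : ∀ {f : ℝ → ℝ}, IsTestFunction f → ∀ i x l,
      fluxVariation (jordanBlock lam mu) (fun _ => u₀) (fun x l => g u₀ l i * deriv f x) x l =
        ∑ k, jordanBlock lam mu u₀ l k * (g u₀ k i * deriv (deriv f) x) := by
    intro f hf i x l
    have hd : deriv (fun x l => g u₀ l i * deriv f x) x =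
        fun l => g u₀ l i * deriv (deriv f) x :=
      (hasDerivAt_pi.2 fun l => (hasDerivAt_of_contDiff hf.deriv.1 x).const_mul _).deriv
    simp [fluxVariation, hd]
  have key := eq_zero_of_integral_mul_eq_zero
    (f := fun x => mu u₀ * g u₀ 1 1 * deriv (deriv ψ₀) x)
    (continuous_const.mul hψ₀.deriv.deriv.1.continuous) ?_ 0
  · rw [hψ₂] at key
    simpa [hmu0 u₀ hu₀] using key
  intro χ₀ hχ₀
  have hL := H.lieDerivative_eq_zero hV (contDiffOn_jordanBlock hlam hmu) hh hA hu
    (isTestCovector_single hψ₀ 1) (isTestCovector_single hχ₀ 0)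
  have h0 : ∀ x, dnOperatorVariation g b (fun _ => u₀)
      (fun y => Matrix.mulVec (jordanBlock lam mu u₀) (deriv (fun _ => u₀) y))
      (fun x => Pi.single 0 (χ₀ x)) x = 0 := by
    intro x
    ext i
    have hz : (fun y : ℝ => Matrix.mulVec (jordanBlock lam mu u₀) (deriv (fun _ => u₀) y)) =
        fun _ => 0 := by ext y; simp
    rw [hz, dnOperatorVariation_apply hV H.smooth_g H.smooth_b hu contDiff_const]
    simp
  simp only [h0, hP hψ₀, hP hχ₀, single_dotProduct, hF hψ₀, hF hχ₀, dotProduct_zero,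
    integral_zero, zero_add, Fin.sum_univ_two] at hL
  have i1 : IsTestFunction (fun x => χ₀ x * (jordanBlock lam mu u₀ 0 0 *
      (g u₀ 0 1 * deriv (deriv ψ₀) x) + jordanBlock lam mu u₀ 0 1 *
      (g u₀ 1 1 * deriv (deriv ψ₀) x))) :=
    hχ₀.mul_right (by have := hψ₀.deriv.deriv.1; fun_prop)
  have i2 : IsTestFunction (fun x => ψ₀ x * (jordanBlock lam mu u₀ 1 0 *
      (g u₀ 0 0 * deriv (deriv χ₀) x) + jordanBlock lam mu u₀ 1 1 *
      (g u₀ 1 0 * deriv (deriv χ₀) x))) :=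
    hψ₀.mul_right (by have := hχ₀.deriv.deriv.1; fun_prop)
  -- Primitive of λ g¹² (ψ₀ χ₀'' - χ₀ ψ₀''): by symmetry of g, only the μ g²² term remains after
  -- integrating by parts.
  have i3 : IsTestFunction (fun x => lam u₀ * g u₀ 0 1 *
      (ψ₀ x * deriv χ₀ x + -1 * (χ₀ x * deriv ψ₀ x))) :=
    ((hψ₀.mul_right hχ₀.deriv.1).add
      ((hχ₀.mul_right hψ₀.deriv.1).mul_left contDiff_const)).mul_left contDiff_const
  rw [← integral_sub i1.integrable i2.integrable] at hL
  refine integral_eq_zero_of_eq_add_deriv (i1.integrable.sub i2.integrable) hL i3 fun x => ?_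
  have d0 := hasDerivAt_of_contDiff hψ₀.1 x
  have d1 := hasDerivAt_of_contDiff hψ₀.deriv.1 x
  have e0 := hasDerivAt_of_contDiff hχ₀.1 x
  have e1 := hasDerivAt_of_contDiff hχ₀.deriv.1 x
  rw [(((d0.fun_mul e1).fun_add ((e0.fun_mul d1).const_mul (-1))).const_mul _).deriv]
  simp only [Pi.sub_apply, jordanBlock, Matrix.of_apply, Matrix.cons_val_zero,
    Matrix.cons_val_one, Matrix.cons_val', Matrix.cons_val_fin_one, H.symm hV hu₀ 1 0]
  ring

/-- This is the coefficient of u¹_xx in the invariance of P, tested with ψ in the first component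
and χ in the second. The contributions of λ b¹²₁ cancel. -/
theorem grad_eq_of_isHamiltonianOperatorOn (hV : IsOpen V)
    (H : IsHamiltonianOperatorOn V g b) (hlam : ContDiffOn ℝ ∞ lam V)
    (hmu : ContDiffOn ℝ ∞ mu V) (hh : ContDiffOn ℝ ∞ h V)
    (hA : ∀ u, IsFieldIn V u → ∀ x, Matrix.mulVec (jordanBlock lam mu (u x)) (deriv u x) =
      dnOperator g b u (fun y => grad h (u y)) x)
    {u₀ : Fin 2 → ℝ} (hu₀ : u₀ ∈ V) : grad lam u₀ 0 * g u₀ 1 0 = mu u₀ * b 1 1 0 u₀ := by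
  obtain ⟨c, hc, hc1⟩ := exists_cutoff (isCompact_singleton (x := (0 : ℝ)))
  replace hc1 : c =ᶠ[𝓝 0] fun _ => 1 := hc1 0 rfl
  have hc0 : c 0 = 1 := hc1.self_of_nhds
  have hcd : deriv c =ᶠ[𝓝 0] fun _ => 0 := by simpa using hc1.deriv
  have hcd0 : deriv c 0 = 0 := hcd.self_of_nhds
  -- The profile 1 - cos x is bounded, with vanishing value and first derivative at 0 and second
  -- derivative 1: there only terms linear in u_xx survive.
  obtain ⟨δ, hδ, hu⟩ := exists_isFieldIn_line hV hu₀ (Pi.single 0 1)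
    (s := fun x => 1 - Real.cos x) (contDiff_const.sub Real.contDiff_cos) (C := 2)
    (fun x => by rw [abs_le]; constructor <;> linarith [Real.cos_le_one x, Real.neg_one_le_cos x])
  have hud : ∀ x, deriv (fun x => u₀ + (δ * (1 - Real.cos x)) • (Pi.single 0 1 : Fin 2 → ℝ)) x =
      (δ * Real.sin x) • Pi.single 0 1 := by
    intro x
    have := ((((Real.hasDerivAt_cos x).const_sub 1).const_mul δ).smul_const
      (Pi.single 0 1 : Fin 2 → ℝ)).const_add u₀
    simpa using this.deriv
  have hu0 : u₀ + (δ * (1 - Real.cos 0)) • (Pi.single 0 1 : Fin 2 → ℝ) = u₀ := by simp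
  generalize hU : (fun x => u₀ + (δ * (1 - Real.cos x)) • (Pi.single 0 1 : Fin 2 → ℝ)) = u
    at hu hud
  replace hu0 : u 0 = u₀ := by rw [← hU]; exact hu0
  have hu'0 : ∀ x, deriv u x 0 = δ * Real.sin x := fun x => by simp [hud]
  have hu'1 : ∀ x, deriv u x 1 = 0 := fun x => by simp [hud]
  have hs : ∀ {F : (Fin 2 → ℝ) → ℝ}, ContDiffOn ℝ ∞ F V →
      HasDerivAt (fun y => F (u y) * (δ * Real.sin y)) (F u₀ * δ) 0 := by
    intro F hF
    have := (hu.hasDerivAt_comp hV hF 0).fun_mul ((Real.hasDerivAt_sin 0).const_mul δ)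
    simpa [hu0] using this
  have hχ := isTestCovector_single (n := 2) hc 1
  have hAs := contDiffOn_jordanBlock hlam hmu
  have hcl : IsTestFunction (fun y => c y * lam (u y)) := hc.mul_right (hu.contDiff_comp hV hlam)
  have hB : ContDiff ℝ ∞ (fun y => ∑ k, b 1 0 k (u y) * deriv u y k) := ContDiff.sum fun k _ =>
    (hu.contDiff_comp hV (H.smooth_b 1 0 k)).mul (contDiff_deriv_apply hu.1 k)
  have hg10 := hu.contDiff_comp hV (H.smooth_g 1 0)
  have hPχ := contDiff_dnOperator hV H.smooth_g H.smooth_b hu hχ.1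
  have hAu : ContDiff ℝ ∞ (fun y => Matrix.mulVec (jordanBlock lam mu (u y)) (deriv u y)) := by
    simp only [hA u hu]
    exact contDiff_dnOperator hV H.smooth_g H.smooth_b hu
      (contDiff_pi.2 fun j => hu.contDiff_comp hV (contDiffOn_grad hV hh j))
  have hdv := contDiff_dnOperatorVariation hV H.smooth_g H.smooth_b hu hAu hχ.1
  have hfl := contDiff_fluxVariation hV hAs hu hPχ
  have heg : IsTestFunction (fun y => deriv (fun y => c y * lam (u y)) y * g (u y) 1 0) :=
    hcl.deriv.mul_right hg10
  -- The function tested is the full coefficient of ψ₀ in the Lie derivative, once all derivatives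
  -- have been moved off ψ₀.
  have key := eq_zero_of_integral_mul_eq_zero (((((contDiff_apply_coord hdv 0).sub
    (contDiff_apply_coord hfl 0)).add heg.deriv.1).sub (hcl.deriv.1.mul hB)).continuous) ?_ 0
  · have hv0 : deriv (fun y => Matrix.mulVec (jordanBlock lam mu (u y)) (deriv u y)) 0 =
        Pi.single 0 (lam u₀ * δ) := by
      ext i
      have h1 := deriv_apply hAu 0 i
      fin_cases i
      · refine h1.unique ?_
        simpa [Matrix.mulVec, dotProduct, jordanBlock, hu'0, hu'1] using hs hlam
      · refine h1.unique ?_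
        simpa [Matrix.mulVec, dotProduct, jordanBlock, hu'0, hu'1] using
          hasDerivAt_const (0 : ℝ) (0 : ℝ)
    have hd0 : deriv u 0 = 0 := by simp [hud]
    have t1 : dnOperatorVariation g b u
        (fun y => Matrix.mulVec (jordanBlock lam mu (u y)) (deriv u y))
        (fun x => Pi.single 1 (c x)) 0 0 = b 0 1 0 u₀ * (lam u₀ * δ) := by
      rw [dnOperatorVariation_apply hV H.smooth_g H.smooth_b hu hAu]
      simp only [hv0]
      simp [hd0, deriv_single hc, hcd0, hc0, hu0]
    have hw : ∀ l, deriv (dnOperator g b u fun x => Pi.single 1 (c x)) 0 l =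
        b l 1 0 u₀ * δ := by
      intro l
      refine (deriv_apply hPχ 0 l).unique ((hs (H.smooth_b l 1 0)).congr_of_eventuallyEq ?_)
      filter_upwards [hc1, hcd] with y h1 h2
      rw [dnOperator_single hc, h1, h2]
      simp [hu'0, hu'1]
    have t2 : fluxVariation (jordanBlock lam mu) u (dnOperator g b u fun x => Pi.single 1 (c x))
        0 0 = lam u₀ * (b 0 1 0 u₀ * δ) + mu u₀ * (b 1 1 0 u₀ * δ) := by
      simp [fluxVariation, hw, hd0, hu0, jordanBlock]
    have t3 : deriv (fun y => deriv (fun y => c y * lam (u y)) y * g (u y) 1 0) 0 =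
        grad lam u₀ 0 * g u₀ 1 0 * δ := by
      refine (((hs ((contDiffOn_grad hV hlam 0).mul (H.smooth_g 1 0)))).congr_of_eventuallyEq
        ?_).deriv
      filter_upwards [hc1.eventuallyEq_nhds] with y hy
      have e : (fun y => c y * lam (u y)) =ᶠ[𝓝 y] fun y => lam (u y) := by
        filter_upwards [hy] with z hz
        rw [hz, one_mul]
      rw [e.deriv_eq, (hu.hasDerivAt_comp hV hlam y).deriv, fderiv_fin_two, hu'0, hu'1]
      ring
    simp only [t1, t2, t3, hd0, Pi.zero_apply, mul_zero, Finset.sum_const_zero, sub_zero] at key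
    have : δ * (grad lam u₀ 0 * g u₀ 1 0) = δ * (mu u₀ * b 1 1 0 u₀) := by linarith
    exact mul_left_cancel₀ hδ.ne' this
  intro ψ₀ hψ₀
  have hψ := isTestCovector_single (n := 2) hψ₀ 0
  have hPψ := isTestCovector_dnOperator hV H.smooth_g H.smooth_b hu hψ
  have hL := H.lieDerivative_eq_zero hV hAs hh hA hu hψ hχ
  have hw1 := hPψ.apply 1
  -- Since u²_x = 0 along the field, the term in χ is c λ ((Pψ)²)_x, with (Pψ)² the second
  -- component. Two integrations by parts free ψ₀ of derivatives; this is their primitive.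
  have hD : IsTestFunction (fun y => deriv (fun y => c y * lam (u y)) y * g (u y) 1 0 * ψ₀ y +
      -1 * (c y * lam (u y) * dnOperator g b u (fun x => Pi.single 0 (ψ₀ x)) y 1)) :=
    (hψ₀.mul_left heg.1).add ((hw1.mul_left hcl.1).mul_left contDiff_const)
  have i1 := hψ.dotProduct hdv
  have i2 := hχ.dotProduct (contDiff_fluxVariation hV hAs hu hPψ.1)
  have i3 := hψ.dotProduct hfl
  rw [← integral_add i1.integrable i2.integrable,
    ← integral_sub (i1.add i2).integrable i3.integrable] at hL
  refine integral_eq_zero_of_eq_add_deriv ((i1.add i2).integrable.sub i3.integrable) hL hD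
    fun y => ?_
  have e1 : fluxVariation (jordanBlock lam mu) u (dnOperator g b u fun x => Pi.single 0 (ψ₀ x))
      y 1 = lam (u y) * deriv (dnOperator g b u fun x => Pi.single 0 (ψ₀ x)) y 1 := by
    simp [fluxVariation, hu'1, jordanBlock]
  rw [(((hasDerivAt_of_contDiff heg.1 y).fun_mul (hasDerivAt_of_contDiff hψ₀.1 y)).fun_add
    (((hasDerivAt_of_contDiff hcl.1 y).fun_mul (deriv_apply hPψ.1 y 1)).const_mul (-1))).deriv]
  simp only [Pi.sub_apply, single_dotProduct, e1, dnOperator_single hψ₀]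
  ring

/-- A Jordan-block system that is Hamiltonian in the Dubrovin–Novikov sense is linearly
degenerate. -/
theorem grad_eq_zero_of_isHamiltonianDNOn (hV : IsOpen V) (hlam : ContDiffOn ℝ ∞ lam V)
    (hmu : ContDiffOn ℝ ∞ mu V) (hmu0 : ∀ u ∈ V, mu u ≠ 0)
    (H : IsHamiltonianDNOn (jordanBlock lam mu) V) : ∀ u ∈ V, grad lam u 0 = 0 := by
  obtain ⟨g, b, h, H, hh, hA⟩ := H
  have h11 := fun u (hu : u ∈ V) => H.metric_eq_zero hV hlam hmu hmu0 hh hA hu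
  intro u hu
  have h1 := grad_eq_of_isHamiltonianOperatorOn hV H hlam hmu hh hA hu
  have h2 := H.grad_eq hV hu 1 1 0
  rw [grad_congr hV h11 hu] at h2
  -- As g²² vanishes on all of V, so does 2 b²²₁ = ∂₁g²².
  have h3 : b 1 1 0 u = 0 := by
    have : grad (fun _ : Fin 2 → ℝ => (0 : ℝ)) u 0 = 0 := by simp [grad]
    linarith
  have h4 : g u 1 0 ≠ 0 := by
    intro h0
    refine H.nondegenerate u hu ?_
    rw [Matrix.det_fin_two, h11 u hu, h0]
    ring
  rw [h3, mul_zero] at h1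
  exact (mul_eq_zero.1 h1).resolve_right h4

end Necessity

/-! ### Hamiltonian operators from commuting frames -/

section Frames

variable {n : ℕ} {V : Set (Fin n → ℝ)} {M : (Fin n → ℝ) → Matrix (Fin n) (Fin n) ℝ}
  {κ : Matrix (Fin n) (Fin n) ℝ} {u v ψ χ η : ℝ → Fin n → ℝ}

/-- The contravariant metric with constant coefficients `κ` in the frame given by the columns
of `M`. -/
def frameMetric (M : (Fin n → ℝ) → Matrix (Fin n) (Fin n) ℝ) (κ : Matrix (Fin n) (Fin n) ℝ)
    (u : Fin n → ℝ) : Matrix (Fin n) (Fin n) ℝ :=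
  M u * κ * (M u).transpose

/-- The coefficients `b^{ij}_k` of the operator `M κ ∂_x Mᵀ`. -/
noncomputable def frameSymbol (M : (Fin n → ℝ) → Matrix (Fin n) (Fin n) ℝ)
    (κ : Matrix (Fin n) (Fin n) ℝ) (i j k : Fin n) (u : Fin n → ℝ) : ℝ :=
  ∑ α, ∑ β, M u i α * κ α β * grad (fun w => M w j β) u k

/-- The components `Mᵀ ψ` of a covector field in the frame given by the columns of `M`. -/
def frameCoord (M : (Fin n → ℝ) → Matrix (Fin n) (Fin n) ℝ) (u ψ : ℝ → Fin n → ℝ) (x : ℝ) :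
    Fin n → ℝ :=
  fun β => ∑ j, M (u x) j β * ψ x j

/-- The linearization of `Mᵀ ψ` at the field `u` in the direction `v`. -/
noncomputable def frameCoordVariation (M : (Fin n → ℝ) → Matrix (Fin n) (Fin n) ℝ)
    (u v ψ : ℝ → Fin n → ℝ) (x : ℝ) : Fin n → ℝ :=
  fun β => ∑ j, fderiv ℝ (fun w => M w j β) (u x) (v x) * ψ x j

/-- Purely algebraic, hence valid for fields that leave V. This matters for linearization, where u +
ε v need not take values in V. -/
theorem dnOperator_frame_expand (u ψ : ℝ → Fin n → ℝ) (x : ℝ) (i : Fin n) :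
    dnOperator (frameMetric M κ) (frameSymbol M κ) u ψ x i =
      ∑ α, ∑ β, M (u x) i α * κ α β * ∑ j, (M (u x) j β * deriv ψ x j +
        fderiv ℝ (fun w => M w j β) (u x) (deriv u x) * ψ x j) := by
  have h1 : ∀ j, frameMetric M κ (u x) i j =
      ∑ α, ∑ β, M (u x) i α * κ α β * M (u x) j β := by
    intro j
    simp only [frameMetric, Matrix.mul_apply, Matrix.transpose_apply, Finset.sum_mul]
    exact Finset.sum_comm
  have h2 : ∀ j, ∑ k, frameSymbol M κ i j k (u x) * deriv u x k =
      ∑ α, ∑ β, M (u x) i α * κ α β * fderiv ℝ (fun w => M w j β) (u x) (deriv u x) := by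
    intro j
    simp only [frameSymbol, ← sum_grad_mul, Finset.sum_mul, Finset.mul_sum]
    rw [Finset.sum_comm]
    refine Finset.sum_congr rfl fun α _ => ?_
    rw [Finset.sum_comm]
    simp only [mul_assoc]
  simp only [dnOperator, ← Finset.sum_mul, h1, h2, ← Finset.sum_add_distrib]
  simp only [Finset.sum_mul, Finset.mul_sum, ← Finset.sum_add_distrib]
  rw [Finset.sum_comm]
  refine Finset.sum_congr rfl fun α _ => ?_
  rw [Finset.sum_comm]
  refine Finset.sum_congr rfl fun β _ => Finset.sum_congr rfl fun j _ => ?_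
  ring

theorem contDiff_frameCoord (hV : IsOpen V) (hM : ∀ i j, ContDiffOn ℝ ∞ (fun u => M u i j) V)
    (hu : IsFieldIn V u) (hψ : ContDiff ℝ ∞ ψ) : ContDiff ℝ ∞ (frameCoord M u ψ) :=
  contDiff_pi.2 fun β => ContDiff.sum fun j _ =>
    (hu.contDiff_comp hV (hM j β)).mul (contDiff_apply_coord hψ j)

theorem isTestCovector_frameCoord (hV : IsOpen V)
    (hM : ∀ i j, ContDiffOn ℝ ∞ (fun u => M u i j) V)
    (hu : IsFieldIn V u) (hψ : IsTestCovector ψ) : IsTestCovector (frameCoord M u ψ) :=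
  isTestCovector_of_apply fun β => IsTestFunction.sum _ fun j _ =>
    (hψ.apply j).mul_left (hu.contDiff_comp hV (hM j β))

theorem isTestCovector_frameCoordVariation (hV : IsOpen V)
    (hM : ∀ i j, ContDiffOn ℝ ∞ (fun u => M u i j) V) (hu : IsFieldIn V u)
    (hv : ContDiff ℝ ∞ v) (hψ : IsTestCovector ψ) :
    IsTestCovector (frameCoordVariation M u v ψ) :=
  isTestCovector_of_apply fun β => IsTestFunction.sum _ fun j _ =>
    (hψ.apply j).mul_left (hu.contDiff_fderiv hV (hM j β) hv)

theorem dnOperator_frame (hV : IsOpen V) (hM : ∀ i j, ContDiffOn ℝ ∞ (fun u => M u i j) V)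
    (hu : IsFieldIn V u) (hψ : ContDiff ℝ ∞ ψ) (x : ℝ) (i : Fin n) :
    dnOperator (frameMetric M κ) (frameSymbol M κ) u ψ x i =
      ∑ α, ∑ β, M (u x) i α * κ α β * deriv (frameCoord M u ψ) x β := by
  rw [dnOperator_frame_expand]
  refine Finset.sum_congr rfl fun α _ => Finset.sum_congr rfl fun β _ => ?_
  congr 1
  have h : HasDerivAt (fun y => ∑ j, M (u y) j β * ψ y j) _ x := HasDerivAt.fun_sum fun j _ =>
    (hu.hasDerivAt_comp hV (hM j β) x).fun_mul (deriv_apply hψ x j)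
  rw [(deriv_apply (contDiff_frameCoord hV hM hu hψ) x β).unique h]
  exact Finset.sum_congr rfl fun j _ => add_comm _ _

/-- Product rule for M κ ∂_x Mᵀ: the ε-derivative commutes with ∂_x because the second derivative of
M is symmetric. -/
theorem dnOperatorVariation_frame (hV : IsOpen V)
    (hM : ∀ i j, ContDiffOn ℝ ∞ (fun u => M u i j) V)
    (hu : IsFieldIn V u) (hv : ContDiff ℝ ∞ v) (hψ : IsTestCovector ψ) (x : ℝ) (i : Fin n) :
    dnOperatorVariation (frameMetric M κ) (frameSymbol M κ) u v ψ x i =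
      ∑ α, ∑ β, (fderiv ℝ (fun w => M w i α) (u x) (v x) * κ α β *
        deriv (frameCoord M u ψ) x β +
        M (u x) i α * κ α β * deriv (frameCoordVariation M u v ψ) x β) := by
  refine HasDerivAt.deriv ?_
  simp only [dnOperator_frame_expand, deriv_add_smul hu.1 hv, Pi.add_apply, Pi.smul_apply]
  refine HasDerivAt.fun_sum fun α _ => HasDerivAt.fun_sum fun β _ => ?_
  have hq : deriv (frameCoord M u ψ) x β = ∑ j, (M (u x) j β * deriv ψ x j +
      fderiv ℝ (fun w => M w j β) (u x) (deriv u x) * ψ x j) := by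
    refine (deriv_apply (contDiff_frameCoord hV hM hu hψ.1) x β).unique ?_
    refine HasDerivAt.fun_sum fun j _ => ?_
    rw [add_comm]
    exact (hu.hasDerivAt_comp hV (hM j β) x).fun_mul (deriv_apply hψ.1 x j)
  have hr : deriv (frameCoordVariation M u v ψ) x β =
      ∑ j, (fderiv ℝ (fun w => M w j β) (u x) (v x) * deriv ψ x j +
        (fderiv ℝ (fderiv ℝ (fun w => M w j β)) (u x) (v x) (deriv u x) +
          fderiv ℝ (fun w => M w j β) (u x) (deriv v x)) * ψ x j) := by
    refine (deriv_apply (isTestCovector_frameCoordVariation hV hM hu hv hψ).1 x β).unique ?_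
    refine HasDerivAt.fun_sum fun j _ => ?_
    rw [add_comm, fderiv_fderiv_comm hV (hM j β) (hu.2 x)]
    exact (hu.hasDerivAt_fderiv hV (hM j β) hv x).fun_mul (deriv_apply hψ.1 x j)
  have hQ : HasDerivAt (fun ε : ℝ => ∑ j, (M (u x + ε • v x) j β * deriv ψ x j +
      fderiv ℝ (fun w => M w j β) (u x + ε • v x) (deriv u x + ε • deriv v x) * ψ x j))
      (deriv (frameCoordVariation M u v ψ) x β) 0 := by
    rw [hr]
    refine HasDerivAt.fun_sum fun j _ => HasDerivAt.add ?_ (HasDerivAt.mul_const ?_ _)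
    · exact (hasDerivAt_line hV (hM j β) (hu.2 x) (v x)).mul_const _
    · have h1 : HasDerivAt (fun ε : ℝ => u x + ε • v x) (v x) 0 := by
        simpa using ((hasDerivAt_id (0 : ℝ)).smul_const (v x)).const_add (u x)
      have h2 : HasDerivAt (fun ε : ℝ => deriv u x + ε • deriv v x) (deriv v x) 0 := by
        simpa using ((hasDerivAt_id (0 : ℝ)).smul_const (deriv v x)).const_add (deriv u x)
      have h3 : HasFDerivAt (fderiv ℝ (fun w => M w j β))
          (fderiv ℝ (fderiv ℝ (fun w => M w j β)) (u x)) (u x + (0 : ℝ) • v x) := by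
        simpa using (differentiableAt_of_contDiffOn hV
          ((hM j β).fderiv_of_isOpen hV (by simp)) (hu.2 x)).hasFDerivAt
      have h4 : HasDerivAt (fun ε : ℝ => fderiv ℝ (fun w => M w j β) (u x + ε • v x))
          (fderiv ℝ (fderiv ℝ (fun w => M w j β)) (u x) (v x)) 0 := h3.comp_hasDerivAt 0 h1
      have h5 := h4.clm_apply h2
      simp only [zero_smul, add_zero] at h5
      exact h5
  have := ((hasDerivAt_line hV (hM i α) (hu.2 x) (v x)).mul_const (κ α β)).fun_mul hQ
  simpa [hq] using this

/-- A frame of commuting vector fields and a constant non-degenerate symmetric matrix define a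
non-degenerate Hamiltonian operator of hydrodynamic type. -/
theorem isHamiltonianOperatorOn_frame (hV : IsOpen V)
    (hM : ∀ i j, ContDiffOn ℝ ∞ (fun u => M u i j) V) (hκ : ∀ α β, κ α β = κ β α)
    (hκ0 : κ.det ≠ 0) (hM0 : ∀ u ∈ V, (M u).det ≠ 0)
    (hcomm : ∀ u ∈ V, ∀ i α β, fderiv ℝ (fun w => M w i α) u (fun j => M u j β) =
      fderiv ℝ (fun w => M w i β) u (fun j => M u j α)) :
    IsHamiltonianOperatorOn V (frameMetric M κ) (frameSymbol M κ) := by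
  have hg : ∀ i j, ContDiffOn ℝ ∞ (fun u => frameMetric M κ u i j) V := by
    intro i j
    simp only [frameMetric, Matrix.mul_apply, Matrix.transpose_apply]
    exact ContDiffOn.sum fun β _ => (ContDiffOn.sum fun α _ =>
      (hM i α).mul contDiffOn_const).mul (hM j β)
  have hb : ∀ i j k, ContDiffOn ℝ ∞ (frameSymbol M κ i j k) V := fun i j k =>
    ContDiffOn.sum fun α _ => ContDiffOn.sum fun β _ =>
      ((hM i α).mul contDiffOn_const).mul (contDiffOn_grad hV (hM j β) k)
  refine ⟨hg, hb, fun u hu => ?_, ?_, ?_⟩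
  · simp [frameMetric, Matrix.det_mul, hM0 u hu, hκ0]
  · intro u hu ψ χ hψ hχ
    have hP := fun {ψ : ℝ → Fin n → ℝ} (hψ : IsTestCovector ψ) =>
      contDiff_dnOperator hV hg hb hu hψ.1
    have hq := fun {ψ : ℝ → Fin n → ℝ} (hψ : IsTestCovector ψ) =>
      isTestCovector_frameCoord hV hM hu hψ
    rw [eq_neg_iff_add_eq_zero, ← integral_add (hψ.dotProduct (hP hχ)).integrable
      (hχ.dotProduct (hP hψ)).integrable]
    -- As κ is constant and symmetric, the symmetrized bracket density is the derivative of (Mᵀψ) ·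
    -- κ (Mᵀχ).
    have hF : IsTestFunction (fun x => ∑ α, ∑ β, κ α β *
        (frameCoord M u ψ x α * frameCoord M u χ x β)) :=
      IsTestFunction.sum _ fun α _ => IsTestFunction.sum _ fun β _ =>
        (((hq hψ).apply α).mul_right ((hq hχ).apply β).1).mul_left contDiff_const
    rw [← hF.integral_deriv]
    refine integral_congr_ae (Eventually.of_forall fun x => ?_)
    have hd : HasDerivAt (fun x => ∑ α, ∑ β, κ α β *
        (frameCoord M u ψ x α * frameCoord M u χ x β)) _ x :=
      HasDerivAt.fun_sum fun α _ => HasDerivAt.fun_sum fun β _ =>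
        ((deriv_apply (hq hψ).1 x α).fun_mul (deriv_apply (hq hχ).1 x β)).const_mul (κ α β)
    have e : ∀ {ψ χ : ℝ → Fin n → ℝ}, IsTestCovector χ →
        ψ x ⬝ᵥ dnOperator (frameMetric M κ) (frameSymbol M κ) u χ x =
        ∑ α, ∑ β, κ α β * (frameCoord M u ψ x α * deriv (frameCoord M u χ) x β) := by
      intro ψ χ hχ
      simp only [dotProduct, dnOperator_frame hV hM hu hχ.1, Finset.mul_sum]
      rw [Finset.sum_comm]
      refine Finset.sum_congr rfl fun α _ => ?_
      rw [Finset.sum_comm]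
      refine Finset.sum_congr rfl fun β _ => ?_
      simp only [frameCoord, Finset.sum_mul, Finset.mul_sum]
      exact Finset.sum_congr rfl fun j _ => by ring
    beta_reduce
    rw [hd.deriv, e hχ, e hψ]
    conv_lhs => arg 2; rw [Finset.sum_comm]
    rw [← Finset.sum_add_distrib]
    refine Finset.sum_congr rfl fun α _ => ?_
    rw [← Finset.sum_add_distrib]
    refine Finset.sum_congr rfl fun β _ => ?_
    rw [hκ β α]
    ring
  · intro u hu ψ χ η hψ hχ hη
    have hP := fun {ψ : ℝ → Fin n → ℝ} (hψ : IsTestCovector ψ) =>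
      contDiff_dnOperator hV hg hb hu hψ.1
    have hq := fun {ψ : ℝ → Fin n → ℝ} (hψ : IsTestCovector ψ) =>
      isTestCovector_frameCoord hV hM hu hψ
    -- Frame components of Pψ, that is κ ∂_x (Mᵀψ).
    let ξ : (ℝ → Fin n → ℝ) → ℝ → Fin n → ℝ := fun ψ x α =>
      ∑ β, κ α β * deriv (frameCoord M u ψ) x β
    have hξ : ∀ {ψ : ℝ → Fin n → ℝ}, IsTestCovector ψ → ∀ α, IsTestFunction (fun x => ξ ψ x α) :=
      fun hψ α => IsTestFunction.sum _ fun β _ => ((hq hψ).deriv_apply β).mul_left contDiff_const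
    have hPξ : ∀ {ψ : ℝ → Fin n → ℝ}, IsTestCovector ψ → ∀ x,
        dnOperator (frameMetric M κ) (frameSymbol M κ) u ψ x =
          ∑ γ, ξ ψ x γ • fun j => M (u x) j γ := by
      intro ψ hψ x
      ext i
      rw [dnOperator_frame hV hM hu hψ.1, Finset.sum_apply]
      refine Finset.sum_congr rfl fun α _ => ?_
      simp only [Pi.smul_apply, smul_eq_mul, ξ, Finset.sum_mul]
      exact Finset.sum_congr rfl fun β _ => by ring
    -- R(ψ, χ, η) pairs the variation of Mᵀψ along Pη with ξ(χ). It is the derivative of the frame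
    -- along Pη, contracted with ψ and ξ(χ), so commutation of the frame makes it symmetric in χ and
    -- η.
    let R : (ℝ → Fin n → ℝ) → (ℝ → Fin n → ℝ) → (ℝ → Fin n → ℝ) → ℝ → ℝ := fun ψ χ η x =>
      ∑ α, frameCoordVariation M u (dnOperator (frameMetric M κ) (frameSymbol M κ) u η) ψ x α *
        ξ χ x α
    have hR : ∀ {ψ χ η : ℝ → Fin n → ℝ}, IsTestCovector ψ → IsTestCovector χ →
        IsTestCovector η → Integrable (R ψ χ η) := fun hψ hχ hη =>
      (IsTestFunction.sum _ fun α _ => (hξ hχ α).mul_left ((isTestCovector_frameCoordVariation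
        hV hM hu (hP hη) hψ).apply α).1).integrable
    have hRs : ∀ {ψ χ η : ℝ → Fin n → ℝ}, IsTestCovector χ → IsTestCovector η →
        R ψ χ η = R ψ η χ := by
      intro ψ χ η hχ hη
      ext x
      simp only [R, frameCoordVariation, hPξ hχ, hPξ hη, map_sum, map_smul, smul_eq_mul,
        Finset.sum_mul]
      conv_lhs => enter [2, α]; rw [Finset.sum_comm]
      conv_rhs => enter [2, α]; rw [Finset.sum_comm]
      rw [Finset.sum_comm]
      refine Finset.sum_congr rfl fun γ _ => Finset.sum_congr rfl fun α _ =>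
        Finset.sum_congr rfl fun j _ => ?_
      rw [hcomm (u x) (hu.2 x)]
      ring
    -- One integration by parts turns each Jacobi term into a difference of two R's; symmetry in the
    -- last two arguments then cancels the six terms of the cyclic sum in pairs.
    have key : ∀ {ψ χ η : ℝ → Fin n → ℝ}, IsTestCovector ψ → IsTestCovector χ →
        IsTestCovector η →
        ∫ x, ψ x ⬝ᵥ dnOperatorVariation (frameMetric M κ) (frameSymbol M κ) u
          (dnOperator (frameMetric M κ) (frameSymbol M κ) u η) χ x =
        (∫ x, R ψ χ η x) - ∫ x, R χ ψ η x := by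
      intro ψ χ η hψ hχ hη
      have hr := fun {ψ : ℝ → Fin n → ℝ} (hψ : IsTestCovector ψ) =>
        isTestCovector_frameCoordVariation hV hM hu (hP hη) hψ
      have hF : IsTestFunction (fun x => ∑ α, ∑ β, κ α β * (frameCoord M u ψ x α *
          frameCoordVariation M u (dnOperator (frameMetric M κ) (frameSymbol M κ) u η) χ x β)) :=
        IsTestFunction.sum _ fun α _ => IsTestFunction.sum _ fun β _ =>
          (((hq hψ).apply α).mul_right ((hr hχ).apply β).1).mul_left contDiff_const
      rw [← integral_sub (hR hψ hχ hη) (hR hχ hψ hη), ← sub_eq_zero, ← hF.integral_deriv,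
        ← integral_sub]
      rotate_left
      · exact (hψ.dotProduct (contDiff_dnOperatorVariation hV hg hb hu (hP hη) hχ.1)).integrable
      · exact (hR hψ hχ hη).sub (hR hχ hψ hη)
      refine integral_congr_ae (Eventually.of_forall fun x => ?_)
      have hd : HasDerivAt (fun x => ∑ α, ∑ β, κ α β * (frameCoord M u ψ x α *
          frameCoordVariation M u (dnOperator (frameMetric M κ) (frameSymbol M κ) u η) χ x β))
          _ x :=
        HasDerivAt.fun_sum fun α _ => HasDerivAt.fun_sum fun β _ =>
          ((deriv_apply (hq hψ).1 x α).fun_mul (deriv_apply (hr hχ).1 x β)).const_mul (κ α β)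
      beta_reduce
      rw [hd.deriv]
      have e1 : ψ x ⬝ᵥ dnOperatorVariation (frameMetric M κ) (frameSymbol M κ) u
          (dnOperator (frameMetric M κ) (frameSymbol M κ) u η) χ x =
          ∑ α, ∑ β, κ α β * (frameCoordVariation M u
            (dnOperator (frameMetric M κ) (frameSymbol M κ) u η) ψ x α *
              deriv (frameCoord M u χ) x β + frameCoord M u ψ x α *
            deriv (frameCoordVariation M u
              (dnOperator (frameMetric M κ) (frameSymbol M κ) u η) χ) x β) := by
        simp only [dotProduct, dnOperatorVariation_frame hV hM hu (hP hη) hχ, Finset.mul_sum]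
        rw [Finset.sum_comm]
        refine Finset.sum_congr rfl fun α _ => ?_
        rw [Finset.sum_comm]
        refine Finset.sum_congr rfl fun β _ => ?_
        rw [frameCoord, frameCoordVariation]
        simp only [Finset.sum_mul, Finset.mul_sum, ← Finset.sum_add_distrib]
        exact Finset.sum_congr rfl fun j _ => by ring
      have e2 : R χ ψ η x = ∑ α, ∑ β, κ α β * (deriv (frameCoord M u ψ) x α *
          frameCoordVariation M u (dnOperator (frameMetric M κ) (frameSymbol M κ) u η) χ x β) := by
        rw [Finset.sum_comm]
        refine Finset.sum_congr rfl fun β _ => ?_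
        simp only [ξ, Finset.mul_sum]
        refine Finset.sum_congr rfl fun α _ => ?_
        rw [hκ β α]
        ring
      have e3 : R ψ χ η x = ∑ α, ∑ β, κ α β * (frameCoordVariation M u
          (dnOperator (frameMetric M κ) (frameSymbol M κ) u η) ψ x α *
            deriv (frameCoord M u χ) x β) := by
        refine Finset.sum_congr rfl fun α _ => ?_
        simp only [ξ, Finset.mul_sum]
        exact Finset.sum_congr rfl fun β _ => by ring
      rw [e1, e2, e3]
      simp only [← Finset.sum_sub_distrib]
      refine Finset.sum_congr rfl fun α _ => Finset.sum_congr rfl fun β _ => ?_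
      ring
    rw [key hψ hχ hη, key hχ hη hψ, key hη hψ hχ, hRs (ψ := ψ) hχ hη, hRs (ψ := χ) hψ hη,
      hRs (ψ := η) hχ hψ]
    ring

end Frames

/-! ### Hamiltonian structure on rectangles -/

section Sufficiency

variable {I J : Set ℝ} {lam mu : (Fin 2 → ℝ) → ℝ}

theorem eq_of_grad_zero_eq_zero (hI : IsOpen I) (hI' : I.OrdConnected) (hJ : IsOpen J) {a : ℝ}
    (ha : a ∈ I) {F : (Fin 2 → ℝ) → ℝ} (hF : ContDiffOn ℝ ∞ F (rectangle I J))
    (h : ∀ u ∈ rectangle I J, grad F u 0 = 0) {u : Fin 2 → ℝ} (hu : u ∈ rectangle I J) :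
    F u = F ![a, u 1] := by
  have hR := isOpen_rectangle hI hJ
  have hd : ∀ s ∈ I, HasDerivAt (fun s => F ![s, u 1]) 0 s := by
    intro s hs
    have hm : ![s, u 1] ∈ rectangle I J := ⟨hs, hu.2⟩
    have := hasDerivAt_comp_fst_coord (differentiableAt_of_contDiffOn hR hF hm)
    rw [h _ hm] at this
    exact this
  have hu' : ![u 0, u 1] = u := by ext i; fin_cases i <;> rfl
  have := hI.is_const_of_deriv_eq_zero hI'.isPreconnected
    (fun s hs => (hd s hs).differentiableAt.differentiableWithinAt)
    (fun s hs => (hd s hs).deriv) hu.1 ha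
  simpa [hu'] using this

/-- A function of the second variable alone has a smooth antiderivative in that variable. -/
theorem exists_antideriv_snd (hI : IsOpen I) (hI' : I.OrdConnected) (hJ : IsOpen J)
    (hJ' : J.OrdConnected) {a b : ℝ} (ha : a ∈ I) (hb : b ∈ J)
    (hlam : ContDiffOn ℝ ∞ lam (rectangle I J))
    (h : ∀ u ∈ rectangle I J, grad lam u 0 = 0) :
    ∃ L : (Fin 2 → ℝ) → ℝ, ContDiffOn ℝ ∞ L (rectangle I J) ∧
      ∀ u ∈ rectangle I J, grad L u 0 = 0 ∧ grad L u 1 = lam u := by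
  -- The coordinates are swapped to reuse the antiderivative in the first variable; u¹ is frozen at
  -- a, which does not change λ.
  have hF : ContDiffOn ℝ ∞ (fun w : Fin 2 → ℝ => lam ![a, w 0]) (rectangle J I) := by
    refine hlam.comp (ContDiff.contDiffOn (contDiff_pi.2 fun i => ?_)) fun w hw => ⟨ha, hw.1⟩
    fin_cases i
    · exact contDiff_const
    · exact contDiff_apply ℝ ℝ 0
  obtain ⟨G, hG, hG', -⟩ := exists_antideriv_rectangle hJ hJ' hI hb hF
  have hT : ∀ u, HasFDerivAt (fun u : Fin 2 → ℝ => (![u 1, a] : Fin 2 → ℝ))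
      ((ContinuousLinearMap.proj (R := ℝ) (φ := fun _ : Fin 2 => ℝ) 1).smulRight
        (Pi.single 0 1 : Fin 2 → ℝ)) u := by
    intro u
    rw [hasFDerivAt_pi']
    intro i
    fin_cases i
    · refine (hasFDerivAt_apply (𝕜 := ℝ) (1 : Fin 2) u).congr_fderiv ?_
      ext p; simp
    · refine (hasFDerivAt_const a u).congr_fderiv ?_
      ext p; simp
  refine ⟨fun u => G ![u 1, a], hG.comp (ContDiff.contDiffOn (contDiff_pi.2 fun i => ?_))
    fun w hw => ⟨hw.2, ha⟩, fun u hu => ?_⟩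
  · fin_cases i
    · exact contDiff_apply ℝ ℝ 1
    · exact contDiff_const
  have hm : ![u 1, a] ∈ rectangle J I := ⟨hu.2, ha⟩
  have hd := (differentiableAt_of_contDiffOn (isOpen_rectangle hJ hI) hG
    hm).hasFDerivAt.comp u (hT u)
  have hd' : fderiv ℝ (fun u : Fin 2 → ℝ => G ![u 1, a]) u = _ := hd.fderiv
  have e : fderiv ℝ G ![u 1, a] (Pi.single 0 1) = lam u := by
    have := hG' _ hm
    rw [grad] at this
    rw [this, eq_of_grad_zero_eq_zero hI hI' hJ ha hlam h hu]
    rfl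
  constructor
  · rw [grad, hd']
    simp
  · rw [grad, hd']
    simp [e]

/-- The metric is the constant antidiagonal one in the coordinates (v, u²), with density h = L v +
(u²)²/2. On an empty rectangle there are no fields and every condition is vacuous. -/
theorem isHamiltonianDNOn_rectangle (hI : IsOpen I) (hI' : I.OrdConnected) (hJ : IsOpen J)
    (hJ' : J.OrdConnected) (hlam : ContDiffOn ℝ ∞ lam (rectangle I J))
    (hmu : ContDiffOn ℝ ∞ mu (rectangle I J)) (hmu0 : ∀ u ∈ rectangle I J, mu u ≠ 0)
    (h : ∀ u ∈ rectangle I J, grad lam u 0 = 0) :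
    IsHamiltonianDNOn (jordanBlock lam mu) (rectangle I J) := by
  have hR := isOpen_rectangle hI hJ
  by_cases hne : I.Nonempty ∧ J.Nonempty
  swap
  · have hempty : ∀ u, u ∉ rectangle I J := fun u hu => hne ⟨⟨_, hu.1⟩, ⟨_, hu.2⟩⟩
    have hfield : ∀ u, ¬ IsFieldIn (rectangle I J) u := fun u hu => hempty _ (hu.2 0)
    exact ⟨fun _ => 1, fun _ _ _ _ => 0, fun _ => 0,
      ⟨fun _ _ => contDiffOn_const, fun _ _ _ => contDiffOn_const, fun u hu => absurd hu (hempty u),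
        fun u hu => absurd hu (hfield u), fun u hu => absurd hu (hfield u)⟩, contDiffOn_const,
      fun u hu => absurd hu (hfield u)⟩
  obtain ⟨⟨a, ha⟩, ⟨b, hb⟩⟩ := hne
  obtain ⟨φ, hφ, hφ0, hφ1, hφa⟩ := exists_integrating_factor hI hI' hJ ha hlam hmu hmu0 h
  obtain ⟨v, hv, hv0, hva⟩ := exists_antideriv_rectangle hI hI' hJ ha (hφ.div hmu hmu0)
  obtain ⟨L, hL, hL'⟩ := exists_antideriv_snd hI hI' hJ hJ' ha hb hlam h
  have hlam1 := contDiffOn_grad hR hlam 1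
  have hv1 := contDiffOn_grad hR hv 1
  have hm := hmu.div hφ fun u _ => (hφ0 u).ne'
  have dat := fun {f : (Fin 2 → ℝ) → ℝ} (hf : ContDiffOn ℝ ∞ f (rectangle I J))
    {u : Fin 2 → ℝ} (hu : u ∈ rectangle I J) => differentiableAt_of_contDiffOn hR hf hu
  -- Both φ and v ∂₂λ have u¹-derivative φ ∂₂λ/μ, and their difference is 1 on u¹ = a.
  have hφv : ∀ u ∈ rectangle I J, φ u = grad lam u 1 * v u + 1 := by
    intro u hu
    have hl0 : ∀ u ∈ rectangle I J, grad (fun w => grad lam w 1) u 0 = 0 := by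
      intro u hu
      rw [grad_grad_comm hR hlam hu, grad_congr hR h hu]
      simp [grad]
    have hD := eq_of_grad_zero_eq_zero hI hI' hJ ha
      (F := fun u => φ u + (-1) * (grad lam u 1 * v u))
      (hφ.add (contDiffOn_const.mul (hlam1.mul hv))) (fun w hw => by
        rw [grad_add (dat hφ hw) (dat (contDiffOn_const.mul (hlam1.mul hv)) hw),
          grad_mul (by fun_prop) (dat (hlam1.mul hv) hw), grad_mul (dat hlam1 hw) (dat hv hw),
          hl0 w hw, hv0 w hw]
        have h1 := hφ1 w hw
        have h2 := hmu0 w hw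
        have h3 : grad (fun _ : Fin 2 → ℝ => (-1 : ℝ)) w 0 = 0 := by simp [grad]
        rw [h3, Pi.div_apply]
        field_simp
        linear_combination h1) hu
    have hv00 : v ![a, u 1] = 0 := hva _ rfl
    have hφ00 : φ ![a, u 1] = 1 := hφa _ rfl
    rw [hv00, hφ00] at hD
    linarith
  have hmv : ∀ u ∈ rectangle I J, mu u / φ u * grad v u 0 = 1 := by
    intro u hu
    rw [hv0 u hu]
    have h1 := hmu0 u hu
    have h2 := (hφ0 u).ne'
    simp only [Pi.div_apply]
    field_simp
  -- Derivative of (μ/φ) ∂₁v = 1 in u², multiplied by μ/φ.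
  have hm1 : ∀ u ∈ rectangle I J, grad (fun w => mu w / φ w) u 1 =
      -(grad (fun w => grad v w 1) u 0 * (mu u / φ u) ^ 2) := by
    intro u hu
    have h1 := grad_mul (dat hm hu) (dat (contDiffOn_grad hR hv 0) hu) 1
    have h2 : grad (fun _ : Fin 2 → ℝ => (1 : ℝ)) u 1 = 0 := by simp [grad]
    rw [grad_congr (f := fun w => (mu / φ) w * grad v w 0) hR hmv hu, h2,
      grad_grad_comm hR hv hu] at h1
    have h3 := hmv u hu
    simp only [Pi.div_apply] at h1
    have h4 : grad (mu / φ) u 1 = grad (fun w => mu w / φ w) u 1 := rfl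
    rw [h4] at h1
    linear_combination -(mu u / φ u) * h1 - grad (fun w => mu w / φ w) u 1 * h3
  -- M is the inverse of the Jacobian matrix of (v, u²): its columns are the coordinate fields of v
  -- and u², which is why they commute.
  let M : (Fin 2 → ℝ) → Matrix (Fin 2) (Fin 2) ℝ := fun u =>
    !![mu u / φ u, -1 * (grad v u 1 * (mu u / φ u)); 0, 1]
  let κ : Matrix (Fin 2) (Fin 2) ℝ := !![0, 1; 1, 0]
  have hM : ∀ i j, ContDiffOn ℝ ∞ (fun u => M u i j) (rectangle I J) := by
    intro i j
    fin_cases i <;> fin_cases j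
    · exact hm
    · exact contDiffOn_const.mul (hv1.mul hm)
    · exact contDiffOn_const
    · exact contDiffOn_const
  have hHam := isHamiltonianOperatorOn_frame (M := M) (κ := κ) hR hM
    (by intro α β; fin_cases α <;> fin_cases β <;> rfl) (by simp [κ, Matrix.det_fin_two])
    (fun u hu => by simp [M, Matrix.det_fin_two, hmu0 u hu, (hφ0 u).ne']) ?_
  swap
  · have h01 : ∀ u ∈ rectangle I J, fderiv ℝ (fun w => M w 0 0) u (fun j => M u j 1) =
        fderiv ℝ (fun w => M w 0 1) u (fun j => M u j 0) := by
      intro u hu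
      have e1 : ∀ p, fderiv ℝ (fun w => M w 0 0) u p =
        grad (fun w => mu w / φ w) u 0 * p 0 + grad (fun w => mu w / φ w) u 1 * p 1 :=
        fun p => fderiv_fin_two _ u p
      have e2 : ∀ p, fderiv ℝ (fun w => M w 0 1) u p =
        grad (fun w => -1 * (grad v w 1 * (mu w / φ w))) u 0 * p 0 +
          grad (fun w => -1 * (grad v w 1 * (mu w / φ w))) u 1 * p 1 :=
        fun p => fderiv_fin_two _ u p
      have e3 := grad_mul (f := fun _ => (-1 : ℝ)) (by fun_prop) (dat (hv1.mul hm) hu) 0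
      have e4 := grad_mul (dat hv1 hu) (dat hm hu) 0
      have e5 : grad (fun _ : Fin 2 → ℝ => (-1 : ℝ)) u 0 = 0 := by simp [grad]
      simp only [Pi.div_apply] at e3 e4
      have e6 : grad (mu / φ) u 0 = grad (fun w => mu w / φ w) u 0 := rfl
      rw [e1, e2, e3, e4, e5, e6, hm1 u hu]
      simp only [M, Matrix.of_apply, Matrix.cons_val_zero, Matrix.cons_val_one, Matrix.cons_val',
        Matrix.cons_val_fin_one]
      ring
    have h1 : ∀ u j p, fderiv ℝ (fun w => M w 1 j) u p = 0 := by
      intro u j p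
      have : (fun w => M w 1 j) = fun _ => (![0, 1] : Fin 2 → ℝ) j := rfl
      rw [this]
      simp
    intro u hu i α β
    fin_cases i
    · fin_cases α <;> fin_cases β
      · rfl
      · exact h01 u hu
      · exact (h01 u hu).symm
      · rfl
    · exact (h1 u α _).trans (h1 u β _).symm
  have hh : ContDiffOn ℝ ∞ (fun u => L u * v u + u 1 * u 1 / 2) (rectangle I J) :=
    (hL.mul hv).add (by fun_prop)
  refine ⟨frameMetric M κ, frameSymbol M κ, fun u => L u * v u + u 1 * u 1 / 2, hHam, hh, ?_⟩
  intro u hu x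
  have hh0 : ∀ w ∈ rectangle I J, ∀ k, grad (fun u => L u * v u + u 1 * u 1 / 2) w k =
      L w * grad v w k + v w * grad L w k + w 1 * (Pi.single k 1 : Fin 2 → ℝ) 1 := by
    intro w hw k
    rw [grad_add (dat (hL.mul hv) hw) (by fun_prop), grad_mul (dat hL hw) (dat hv hw)]
    congr 1
    have hp : HasFDerivAt (fun u : Fin 2 → ℝ => u 1)
        (ContinuousLinearMap.proj (R := ℝ) (φ := fun _ : Fin 2 => ℝ) 1) w :=
      hasFDerivAt_apply (𝕜 := ℝ) (1 : Fin 2) w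
    have := ((hp.mul hp).mul_const (2⁻¹ : ℝ)).fderiv
    simp only [div_eq_mul_inv, grad]
    erw [this]
    simp
    ring
  have hgrad : ContDiff ℝ ∞ (fun y => grad (fun u => L u * v u + u 1 * u 1 / 2) (u y)) :=
    contDiff_pi.2 fun j => hu.contDiff_comp hR (contDiffOn_grad hR hh j)
  have hq := contDiff_frameCoord hR hM hu hgrad
  -- The frame components of ∂h/∂u are the partial derivatives of h in the coordinates (v, u²),
  -- namely L here and λ v + u² in `q1`.
  have q0 : deriv (frameCoord M u
      (fun y => grad (fun u => L u * v u + u 1 * u 1 / 2) (u y))) x 0 =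
      lam (u x) * deriv u x 1 := by
    have e : (fun y => frameCoord M u
        (fun y => grad (fun u => L u * v u + u 1 * u 1 / 2) (u y)) y 0) = fun y => L (u y) := by
      ext y
      simp only [frameCoord, Fin.sum_univ_two, hh0 _ (hu.2 y), (hL' _ (hu.2 y)).1]
      simp [M]
      linear_combination L (u y) * hmv _ (hu.2 y)
    have hd := deriv_apply hq x 0
    rw [e] at hd
    rw [hd.unique (hu.hasDerivAt_comp hR hL x), fderiv_fin_two, (hL' _ (hu.2 x)).1,
      (hL' _ (hu.2 x)).2]
    ring
  have q1 : deriv (frameCoord M u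
      (fun y => grad (fun u => L u * v u + u 1 * u 1 / 2) (u y))) x 1 =
      (grad lam (u x) 1 * deriv u x 1) * v (u x) + lam (u x) *
        (grad v (u x) 0 * deriv u x 0 + grad v (u x) 1 * deriv u x 1) + deriv u x 1 := by
    have e : (fun y => frameCoord M u
        (fun y => grad (fun u => L u * v u + u 1 * u 1 / 2) (u y)) y 1) =
        fun y => lam (u y) * v (u y) + u y 1 := by
      ext y
      simp only [frameCoord, Fin.sum_univ_two, hh0 _ (hu.2 y), (hL' _ (hu.2 y)).1,
        (hL' _ (hu.2 y)).2]
      simp [M]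
      linear_combination -(L (u y) * grad v (u y) 1) * hmv _ (hu.2 y)
    have hd := deriv_apply hq x 1
    rw [e] at hd
    rw [hd.unique (((hu.hasDerivAt_comp hR hlam x).fun_mul (hu.hasDerivAt_comp hR hv x)).fun_add
      (deriv_apply hu.1 x 1)), fderiv_fin_two, fderiv_fin_two, h _ (hu.2 x)]
    ring
  have hmφ : mu (u x) / φ (u x) * φ (u x) = mu (u x) := div_mul_cancel₀ _ (hφ0 _).ne'
  ext i
  rw [dnOperator_frame hR hM hu hgrad]
  simp only [Fin.sum_univ_two, q0, q1]
  fin_cases i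
  · simp [M, κ, jordanBlock, Matrix.mulVec, dotProduct, Fin.sum_univ_two]
    -- The coefficient of u²_x produced by the operator is (μ/φ)(v ∂₂λ + 1), which equals μ by
    -- `hφv`.
    linear_combination -(lam (u x) * deriv u x 0) * hmv _ (hu.2 x) -
      deriv u x 1 * hmφ + mu (u x) / φ (u x) * deriv u x 1 * hφv _ (hu.2 x)
  · simp [M, κ, jordanBlock, Matrix.mulVec, dotProduct, Fin.sum_univ_two]

end Sufficiency

end HydroType

/-! ### The equivalences, all routed through ∂₁λ = 0 -/

theorem mainTheorem1 (Ω : Set (Fin 2 → ℝ)) (hΩ : IsOpen Ω)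
    (lam mu : (Fin 2 → ℝ) → ℝ)
    (hlam : ContDiffOn ℝ ∞ lam Ω) (hmu : ContDiffOn ℝ ∞ mu Ω)
    (hmu0 : ∀ u ∈ Ω, mu u ≠ 0) :
    List.TFAE [
      -- linear degeneracy
      HydroType.LinearlyDegenerateOn (HydroType.jordanBlock lam mu) Ω,
      -- the eigenvalue does not depend on the first field variable
      ∀ u ∈ Ω, HydroType.grad lam u 0 = 0,
      -- nontrivial quasilinear differential constraints exist locally
      ∀ u₀ ∈ Ω, ∃ (t₀ x₀ : ℝ) (W : Set (ℝ × ℝ × (Fin 2 → ℝ))) (φ : ℝ × ℝ × (Fin 2 → ℝ) → ℝ),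
        IsOpen W ∧ (t₀, x₀, u₀) ∈ W ∧ (∀ w ∈ W, w.2.2 ∈ Ω) ∧
        HydroType.IsCompatibleConstraint lam mu W φ ∧ W ⊆ closure {w ∈ W | φ w ≠ 0},
      -- nowhere vanishing ones exist on every open rectangle, for all times and positions
      ∀ I J : Set ℝ, IsOpen I → I.OrdConnected → IsOpen J → J.OrdConnected →
        HydroType.rectangle I J ⊆ Ω →
        ∃ φ : ℝ × ℝ × (Fin 2 → ℝ) → ℝ,
          HydroType.IsCompatibleConstraint lam mu {w | w.2.2 ∈ HydroType.rectangle I J} φ ∧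
          ∀ w, w.2.2 ∈ HydroType.rectangle I J → φ w ≠ 0,
      -- the system is locally Hamiltonian
      ∀ u₀ ∈ Ω, ∃ V : Set (Fin 2 → ℝ), IsOpen V ∧ u₀ ∈ V ∧ V ⊆ Ω ∧
        HydroType.IsHamiltonianDNOn (HydroType.jordanBlock lam mu) V,
      -- the system is Hamiltonian on every open rectangle
      ∀ I J : Set ℝ, IsOpen I → I.OrdConnected → IsOpen J → J.OrdConnected →
        HydroType.rectangle I J ⊆ Ω →
        HydroType.IsHamiltonianDNOn (HydroType.jordanBlock lam mu) (HydroType.rectangle I J)] := by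
  tfae_have 1 ↔ 2 := HydroType.linearlyDegenerateOn_jordanBlock_iff hΩ hlam hmu0
  tfae_have 2 → 4 := fun h I J hI hI' hJ _ hsub =>
    HydroType.exists_isCompatibleConstraint_rectangle hI hI' hJ (hlam.mono hsub) (hmu.mono hsub)
      (fun u hu => hmu0 u (hsub hu)) fun u hu => h u (hsub hu)
  tfae_have 4 → 3 := by
    intro h u₀ hu₀
    obtain ⟨I, J, hI, hI', hJ, hJ', hu, hsub⟩ := HydroType.exists_rectangle_subset hΩ hu₀
    obtain ⟨φ, hφ, hφ0⟩ := h I J hI hI' hJ hJ' hsub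
    refine ⟨0, 0, {w | w.2.2 ∈ HydroType.rectangle I J}, φ,
      (HydroType.isOpen_rectangle hI hJ).preimage (by fun_prop), hu,
      fun w hw => hsub hw, hφ, fun w hw => subset_closure ⟨hw, hφ0 w hw⟩⟩
  tfae_have 3 → 2 := by
    intro h u hu
    obtain ⟨t, x, W, φ, hW, hmem, hWΩ, hc, hcl⟩ := h u hu
    exact HydroType.grad_eq_zero_of_isCompatibleConstraint hΩ hlam hW hWΩ hc hcl hmem
  tfae_have 2 → 6 := fun h I J hI hI' hJ hJ' hsub =>
    HydroType.isHamiltonianDNOn_rectangle hI hI' hJ hJ' (hlam.mono hsub) (hmu.mono hsub)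
      (fun u hu => hmu0 u (hsub hu)) fun u hu => h u (hsub hu)
  tfae_have 6 → 5 := by
    intro h u₀ hu₀
    obtain ⟨I, J, hI, hI', hJ, hJ', hu, hsub⟩ := HydroType.exists_rectangle_subset hΩ hu₀
    exact ⟨_, HydroType.isOpen_rectangle hI hJ, hu, hsub, h I J hI hI' hJ hJ' hsub⟩
  tfae_have 5 → 2 := by
    intro h u hu
    obtain ⟨V, hV, hmem, hsub, H⟩ := h u hu
    exact HydroType.grad_eq_zero_of_isHamiltonianDNOn hV (hlam.mono hsub) (hmu.mono hsub)
      (fun w hw => hmu0 w (hsub hw)) H u hmem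
  tfae_finish
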